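/- Let $G$ be a compact connected semisimple Lie group with Lie algebra $\mathfrak g$ and Killing form $B$ (so $-B$ is positive definite), let $H\subset G$ be a closed subgroup with Lie algebra $\mathfrak h$ such that $\mathfrak h$ contains no non-zero ideal of $\mathfrak g$, and let $\mathfrak p$ be the $B$-orthogonal complement of $\mathfrak h$ in $\mathfrak g$, which is identified with the tangent space of $G/H$ at $eH$. Identify the $G$-invariant Riemannian metrics on $G/H$ with the $\mathrm{Ad}(H)$-invariant inner products on $\mathfrak p$, let $S$ denote the scalar curvature of such a metric, and let $\mathcal M_1$ be the set of the $\mathrm{Ad}(H)$-invariant inner products on $\mathfrak p$ that have the same volume as the standard one, $(\cdot,\cdot)=-B|_{\mathfrak p}$. Suppose that the standard metric $(\cdot,\cdot)$ is Einstein, and let $c$ be its Casimir constant, i.e. the number such that the Casimir operator $-\sum_i \mathrm{ad}(z_i)^2|_{\mathfrak p}$, with $(z_i)$ a $(-B)$-orthonormal basis of $\mathfrak h$, equals $c\cdot\mathrm{Id}_{\mathfrak p}$ (equivalently, $\mathrm{Ric}=\left(\tfrac14+\tfrac c2\right)(\cdot,\cdot)$). If $c>3/10$, then $(\cdot,\cdot)$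 is a point of local minimum of the functional $S$ on $\mathcal M_1$. -/

import Mathlib

open scoped Manifold ContDiff Topology

noncomputable section

/-! ### Algebraic part: curvature of a reductive decomposition

`𝔤` is a real Lie algebra, `𝔥` a subspace (in the application the Lie algebra of the isotropy
group), and `𝔭` is the orthogonal complement of `𝔥` with respect to the Killing form. -/

namespace HomogeneousSpace

open LinearMap (BilinForm)

section Algebra

variable {𝔤 : Type*} [LieRing 𝔤] [LieAlgebra ℝ 𝔤]

/-- The subspace `𝔭`, the orthogonal complement of `𝔥` in `𝔤` with respect to the Killing form
(equivalently, with respect to minus the Killing form). -/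
def complement (𝔥 : Submodule ℝ 𝔤) : Submodule ℝ 𝔤 :=
  BilinForm.orthogonal (killingForm ℝ 𝔤) 𝔥

open Classical in
/-- The projection `X ↦ X_𝔭` of `𝔤 = 𝔭 ⊕ 𝔥` onto `𝔭`. (The direct sum decomposition holds whenever
minus the Killing form is positive definite; otherwise the value is `0` by convention.) -/
def projP (𝔥 : Submodule ℝ 𝔤) : 𝔤 →ₗ[ℝ] complement 𝔥 :=
  if h : IsCompl (complement 𝔥) 𝔥 then Submodule.projectionOnto (complement 𝔥) 𝔥 h else 0

/-- The `𝔥`-component `X_𝔥 = X - X_𝔭` of `X`. -/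
def projH (𝔥 : Submodule ℝ 𝔤) : 𝔤 →ₗ[ℝ] 𝔤 :=
  LinearMap.id - (complement 𝔥).subtype ∘ₗ projP 𝔥

/-- The bilinear map `(X, Y) ↦ [X, Y]_𝔭` on `𝔭`. -/
def bracketP (𝔥 : Submodule ℝ 𝔤) :
    complement 𝔥 →ₗ[ℝ] complement 𝔥 →ₗ[ℝ] complement 𝔥 :=
  LinearMap.mk₂ ℝ (fun X Y => projP 𝔥 ⁅(X : 𝔤), (Y : 𝔤)⁆)
    (by intros; simp) (by intros; simp) (by intros; simp) (by intros; simp)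

/-- The right-hand side of the Koszul formula of the invariant metric given by `m`:
`½ (m([X, Y]_𝔭, Z) - m([Y, Z]_𝔭, X) + m([Z, X]_𝔭, Y))`, as a linear form in `Z`. -/
def koszul (𝔥 : Submodule ℝ 𝔤) (m : BilinForm ℝ (complement 𝔥)) (X Y : complement 𝔥) :
    Module.Dual ℝ (complement 𝔥) where
  toFun Z := (1 / 2 : ℝ) *
    (m (bracketP 𝔥 X Y) Z - m (bracketP 𝔥 Y Z) X + m (bracketP 𝔥 Z X) Y)
  map_add' Z W := by simp only [map_add, LinearMap.add_apply]; ring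
  map_smul' a Z := by
    simp only [map_smul, LinearMap.smul_apply, smul_eq_mul, RingHom.id_apply]; ring

variable [FiniteDimensional ℝ 𝔤]

/-- The Levi-Civita connection, at the base point, of the invariant metric given by the
nondegenerate symmetric bilinear form `m` on `𝔭`: the bilinear map `Λ : 𝔭 × 𝔭 → 𝔭` with
`m(Λ(X)Y, Z) = ½ (m([X, Y]_𝔭, Z) - m([Y, Z]_𝔭, X) + m([Z, X]_𝔭, Y))`; it is the unique one which is
torsion-free, `Λ(X)Y - Λ(Y)X = [X, Y]_𝔭`, and metric, `m(Λ(X)Y, Z) + m(Y, Λ(X)Z) = 0`. -/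
def leviCivita (𝔥 : Submodule ℝ 𝔤) (m : BilinForm ℝ (complement 𝔥)) (hm : m.Nondegenerate) :
    complement 𝔥 →ₗ[ℝ] complement 𝔥 →ₗ[ℝ] complement 𝔥 :=
  LinearMap.mk₂ ℝ (fun X Y => (m.toDual hm).symm (koszul 𝔥 m X Y))
    (by
      intro X X' Y; rw [← map_add]; congr 1; ext Z
      simp only [koszul, map_add, LinearMap.add_apply, LinearMap.coe_mk, AddHom.coe_mk]; ring)
    (by
      intro a X Y; rw [← map_smul]; congr 1; ext Z
      simp only [koszul, map_smul, LinearMap.smul_apply, LinearMap.coe_mk, AddHom.coe_mk,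
        smul_eq_mul]; ring)
    (by
      intro X Y Y'; rw [← map_add]; congr 1; ext Z
      simp only [koszul, map_add, LinearMap.add_apply, LinearMap.coe_mk, AddHom.coe_mk]; ring)
    (by
      intro a X Y; rw [← map_smul]; congr 1; ext Z
      simp only [koszul, map_smul, LinearMap.smul_apply, LinearMap.coe_mk, AddHom.coe_mk,
        smul_eq_mul]; ring)

/-- The Riemann curvature tensor of the invariant metric at the base point,
`R(X, Y)Z = Λ(X)Λ(Y)Z - Λ(Y)Λ(X)Z - Λ([X, Y]_𝔭)Z - [[X, Y]_𝔥, Z]`, as a function of `X`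
(the last term lies in `𝔭`, so that the projection only changes its type). -/
def curvature (𝔥 : Submodule ℝ 𝔤) (m : BilinForm ℝ (complement 𝔥)) (hm : m.Nondegenerate)
    (Y Z : complement 𝔥) : complement 𝔥 →ₗ[ℝ] complement 𝔥 where
  toFun X := leviCivita 𝔥 m hm X (leviCivita 𝔥 m hm Y Z)
    - leviCivita 𝔥 m hm Y (leviCivita 𝔥 m hm X Z)
    - leviCivita 𝔥 m hm (bracketP 𝔥 X Y) Z
    - projP 𝔥 ⁅projH 𝔥 ⁅(X : 𝔤), (Y : 𝔤)⁆, (Z : 𝔤)⁆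
  map_add' X X' := by
    simp only [map_add, LinearMap.add_apply, Submodule.coe_add, add_lie]; abel
  map_smul' a X := by
    simp only [map_smul, LinearMap.smul_apply, Submodule.coe_smul, smul_lie, RingHom.id_apply,
      smul_sub]

/-- The Ricci curvature `Ric(Y, Z) = tr (X ↦ R(X, Y)Z)` of the invariant metric at the base
point. -/
def ricci (𝔥 : Submodule ℝ 𝔤) (m : BilinForm ℝ (complement 𝔥)) (hm : m.Nondegenerate) :
    BilinForm ℝ (complement 𝔥) :=
  LinearMap.mk₂ ℝ (fun Y Z => LinearMap.trace ℝ (complement 𝔥) (curvature 𝔥 m hm Y Z))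
    (by
      intro Y Y' Z; rw [← map_add]; congr 1; ext1 X
      simp only [curvature, map_add, LinearMap.add_apply, LinearMap.coe_mk, AddHom.coe_mk,
        Submodule.coe_add, lie_add, add_lie]; abel)
    (by
      intro a Y Z; rw [← map_smul]; congr 1; ext1 X
      simp only [curvature, map_smul, LinearMap.smul_apply, LinearMap.coe_mk, AddHom.coe_mk,
        Submodule.coe_smul, lie_smul, smul_lie, smul_sub])
    (by
      intro Y Z Z'; rw [← map_add]; congr 1; ext1 X
      simp only [curvature, map_add, LinearMap.add_apply, LinearMap.coe_mk, AddHom.coe_mk,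
        Submodule.coe_add, lie_add]; abel)
    (by
      intro a Y Z; rw [← map_smul]; congr 1; ext1 X
      simp only [curvature, map_smul, LinearMap.smul_apply, LinearMap.coe_mk, AddHom.coe_mk,
        Submodule.coe_smul, lie_smul, smul_sub])

/-- The scalar curvature of the invariant metric: the trace, with respect to `m`, of its Ricci
curvature. -/
def scalar (𝔥 : Submodule ℝ 𝔤) (m : BilinForm ℝ (complement 𝔥)) (hm : m.Nondegenerate) : ℝ :=
  LinearMap.trace ℝ (complement 𝔥) ((m.toDual hm).symm.toLinearMap ∘ₗ ricci 𝔥 m hm)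

end Algebra

/-! ### Lie groups and their closed subgroups -/

instance : ENat.LEInfty (minSmoothness ℝ 3) := by
  rw [minSmoothness_of_isRCLikeNormedField]; infer_instance

section Group

variable {E : Type*} [NormedAddCommGroup E] [NormedSpace ℝ E]
  {G : Type*} [TopologicalSpace G] [ChartedSpace E G] [Group G]

instance [FiniteDimensional ℝ E] : FiniteDimensional ℝ (GroupLieAlgebra 𝓘(ℝ, E) G) :=
  inferInstanceAs (FiniteDimensional ℝ E)

variable (E) in
/-- The adjoint representation: `Ad g` is the differential at the identity of the conjugation
`x ↦ g x g⁻¹`. -/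
def Ad (g : G) : GroupLieAlgebra 𝓘(ℝ, E) G → GroupLieAlgebra 𝓘(ℝ, E) G :=
  mfderiv 𝓘(ℝ, E) 𝓘(ℝ, E) (fun x : G => g * x * g⁻¹) 1

/-- `X` is the velocity at time `0` of the curve `γ` in `G`. -/
def HasVelocity (γ : ℝ → G) (X : GroupLieAlgebra 𝓘(ℝ, E) G) : Prop :=
  HasMFDerivAt 𝓘(ℝ, ℝ) 𝓘(ℝ, E) γ 0 (ContinuousLinearMap.toSpanSingleton ℝ (X : E))

theorem HasVelocity.const : HasVelocity (fun _ : ℝ => (1 : G)) (0 : GroupLieAlgebra 𝓘(ℝ, E) G) := by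
  refine (hasMFDerivAt_const (1 : G) (0 : ℝ)).congr_mfderiv ?_
  ext1
  change (0 : E) = (1 : ℝ) • (0 : E)
  rw [smul_zero]

theorem HasVelocity.smul {γ : ℝ → G} {X : GroupLieAlgebra 𝓘(ℝ, E) G} (a : ℝ)
    (hX : HasVelocity γ X) : HasVelocity (fun t => γ (a * t)) (a • X) := by
  unfold HasVelocity at *
  have h0 : HasMFDerivAt 𝓘(ℝ, ℝ) 𝓘(ℝ, ℝ) (fun t : ℝ => a * t) 0
      (a • ContinuousLinearMap.id ℝ ℝ) := by
    have := (hasDerivAt_id (0 : ℝ)).const_mul a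
    refine HasFDerivAt.hasMFDerivAt ?_
    refine this.hasFDerivAt.congr_fderiv ?_
    ext1; simp
  have hX' : HasMFDerivAt 𝓘(ℝ, ℝ) 𝓘(ℝ, E) γ (a * 0)
      (ContinuousLinearMap.toSpanSingleton ℝ (X : E)) := by
    rw [mul_zero]; exact hX
  refine (hX'.comp (0 : ℝ) h0).congr_mfderiv ?_
  ext1
  change (a • (1 : ℝ)) • (X : E) = (1 : ℝ) • (a • (X : E))
  rw [smul_eq_mul, mul_one, one_smul]

variable [LieGroup 𝓘(ℝ, E) ∞ G]

theorem HasVelocity.mul {γ δ : ℝ → G} {X Y : GroupLieAlgebra 𝓘(ℝ, E) G} (h1 : γ 0 = 1)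
    (h2 : δ 0 = 1) (hX : HasVelocity γ X) (hY : HasVelocity δ Y) :
    HasVelocity (fun t => γ t * δ t) (X + Y) := by
  unfold HasVelocity at *
  have hd : MDifferentiableAt (𝓘(ℝ, E).prod 𝓘(ℝ, E)) 𝓘(ℝ, E) (fun p : G × G => p.1 * p.2)
      (γ 0, δ 0) :=
    (contMDiff_mul 𝓘(ℝ, E) ∞ (G := G)).mdifferentiableAt (by simp)
  have hc := hd.hasMFDerivAt.comp (0 : ℝ) (hX.prodMk hY)
  refine hc.congr_mfderiv ?_
  ext1
  have key := mfderiv_prod_eq_add_apply (v := (((X : E), (Y : E)) : E × E)) hd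
  have e1 : (fun z : G => z * δ 0) = id := by ext z; simp [h2]
  have e2 : (fun z : G => γ 0 * z) = id := by ext z; simp [h1]
  have k1 : mfderiv 𝓘(ℝ, E) 𝓘(ℝ, E) (fun z : G => z * δ 0) (γ 0) = ContinuousLinearMap.id ℝ E := by
    rw [e1]; exact mfderiv_id
  have k2 : mfderiv 𝓘(ℝ, E) 𝓘(ℝ, E) (fun z : G => γ 0 * z) (δ 0) = ContinuousLinearMap.id ℝ E := by
    rw [e2]; exact mfderiv_id
  have k3 : mfderiv (𝓘(ℝ, E).prod 𝓘(ℝ, E)) 𝓘(ℝ, E) (fun p : G × G => p.1 * p.2) (γ 0, δ 0)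
      ((X : E), (Y : E)) = (X : E) + (Y : E) :=
    key.trans (congrArg₂ (fun (f g : E →L[ℝ] E) => f (X : E) + g (Y : E)) k1 k2)
  have k4 : ((1 : ℝ) • (X : E), (1 : ℝ) • (Y : E)) = ((X : E), (Y : E)) := by
    rw [one_smul, one_smul]
  change mfderiv (𝓘(ℝ, E).prod 𝓘(ℝ, E)) 𝓘(ℝ, E) (fun p : G × G => p.1 * p.2) (γ 0, δ 0)
    ((1 : ℝ) • (X : E), (1 : ℝ) • (Y : E)) = (1 : ℝ) • ((X : E) + (Y : E))
  refine (congrArg _ k4).trans (k3.trans ?_)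
  exact (one_smul ℝ ((X : E) + (Y : E))).symm

variable (E) in
/-- The Lie algebra `𝔥` of a closed subgroup `H` of the Lie group `G`: the space of all velocities at
the identity of curves in `H`. -/
def lieAlgebra (H : Subgroup G) : Submodule ℝ (GroupLieAlgebra 𝓘(ℝ, E) G) where
  carrier := {X | ∃ γ : ℝ → G, γ 0 = 1 ∧ (∀ t, γ t ∈ H) ∧ HasVelocity γ X}
  zero_mem' := ⟨fun _ => 1, rfl, fun _ => H.one_mem, HasVelocity.const⟩
  add_mem' := by
    rintro X Y ⟨γ, h1, hγ, hX⟩ ⟨δ, h2, hδ, hY⟩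
    exact ⟨fun t => γ t * δ t, by simp [h1, h2], fun t => H.mul_mem (hγ t) (hδ t),
      hX.mul h1 h2 hY⟩
  smul_mem' := by
    rintro a X ⟨γ, h1, hγ, hX⟩
    exact ⟨fun t => γ (a * t), by simp [h1], fun t => hγ _, hX.smul a⟩

variable [FiniteDimensional ℝ E]

variable (E) in
/-- The `Ad(H)`-module `𝔭`, orthogonal to `𝔥` for the Killing form, which is identified with the
tangent space of `G/H` at the base point. -/
abbrev TangentModule (H : Subgroup G) : Submodule ℝ (GroupLieAlgebra 𝓘(ℝ, E) G) :=
  complement (lieAlgebra E H)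

variable (E) in
/-- `G`-invariant Riemannian metrics on `G/H`, as `Ad(H)`-invariant inner products on `𝔭`. -/
structure InvariantMetric (H : Subgroup G) where
  /-- the inner product on `𝔭` -/
  form : LinearMap.BilinForm ℝ (TangentModule E H)
  symm : ∀ X Y, form X Y = form Y X
  pos : ∀ X, X ≠ 0 → 0 < form X X
  /-- for `h ∈ H` and `X, Y ∈ 𝔭` one has `(Ad h X, Ad h Y) = (X, Y)`; the vectors `Ad h X`, `Ad h Y`
  of `𝔭` are called `X'`, `Y'` -/
  invariant : ∀ h ∈ H, ∀ X Y X' Y' : TangentModule E H,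
    Ad E h X = X' → Ad E h Y = Y' → form X' Y' = form X Y

namespace InvariantMetric

variable {H : Subgroup G}

theorem nondegenerate (m : InvariantMetric E H) : m.form.Nondegenerate := by
  constructor
  · intro X hX
    by_contra h
    exact (m.pos X h).ne' (hX X)
  · intro X hX
    by_contra h
    exact (m.pos X h).ne' (hX X)

/-- The topology of the space of inner products on the finite-dimensional space `𝔭`: that of
convergence of all the values. -/
instance : TopologicalSpace (InvariantMetric E H) :=
  TopologicalSpace.induced (fun m X Y => m.form X Y)
    (inferInstance : TopologicalSpace (TangentModule E H → TangentModule E H → ℝ))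

/-- The Ricci curvature of an invariant metric. -/
def ricciCurvature (m : InvariantMetric E H) : LinearMap.BilinForm ℝ (TangentModule E H) :=
  ricci (lieAlgebra E H) m.form m.nondegenerate

/-- The scalar curvature functional `S` on the invariant metrics. -/
def scalarCurvature (m : InvariantMetric E H) : ℝ :=
  scalar (lieAlgebra E H) m.form m.nondegenerate

/-- The metric is Einstein: `Ric = r (·,·)` for a real constant `r`. -/
def IsEinstein (m : InvariantMetric E H) : Prop :=
  ∃ r : ℝ, ∀ X Y, m.ricciCurvature X Y = r * m.form X Y

/-- The metric is standard: it is the restriction of minus the Killing form of `𝔤`. -/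
def IsStandard (m : InvariantMetric E H) : Prop :=
  ∀ X Y : TangentModule E H,
    m.form X Y = -killingForm ℝ (GroupLieAlgebra 𝓘(ℝ, E) G)
      (X : GroupLieAlgebra 𝓘(ℝ, E) G) (Y : GroupLieAlgebra 𝓘(ℝ, E) G)

/-- The volume of an inner product on `𝔭` (up to a positive factor depending on `G/H` only, the volume
of `G/H` with the invariant metric): the square root of its Gram determinant in a fixed basis. -/
def volume (m : InvariantMetric E H) : ℝ :=
  √(LinearMap.BilinForm.toMatrix (Module.finBasis ℝ (TangentModule E H)) m.form).det

/-- The set `𝓜₁` of the invariant metrics of a fixed volume `v`. -/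
def ofVolume (H : Subgroup G) (v : ℝ) : Set (InvariantMetric E H) := {m | m.volume = v}

end InvariantMetric

variable (E) in
/-- `c` is the Casimir constant: the Casimir operator `X ↦ -∑ᵢ [zᵢ, [zᵢ, X]]` of the `𝔥`-module `𝔭`,
where `z₁, z₂, …` is an orthonormal basis of `𝔥` with respect to minus the Killing form of `𝔤`, has
the eigenvalue `c`. (For a standard Einstein metric the operator is scalar, so that `c` is its only
eigenvalue.) -/
def IsCasimirConstant (H : Subgroup G) (c : ℝ) : Prop :=
  ∃ z : Module.Basis (Fin (Module.finrank ℝ (lieAlgebra E H))) ℝ (lieAlgebra E H),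
    (∀ i j, -killingForm ℝ (GroupLieAlgebra 𝓘(ℝ, E) G)
      (z i : GroupLieAlgebra 𝓘(ℝ, E) G) (z j : GroupLieAlgebra 𝓘(ℝ, E) G) = if i = j then 1 else 0) ∧
    ∃ X ∈ TangentModule E H, X ≠ 0 ∧
      -∑ i, ⁅(z i : GroupLieAlgebra 𝓘(ℝ, E) G), ⁅(z i : GroupLieAlgebra 𝓘(ℝ, E) G), X⁆⁆ = c • X

variable (E) in
/-- `G/H` is almost effective: no non-zero ideal of `𝔤` is contained in `𝔥`. -/
def IsAlmostEffective (H : Subgroup G) : Prop :=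
  ∀ J : LieIdeal ℝ (GroupLieAlgebra 𝓘(ℝ, E) G), (∀ X ∈ J, X ∈ lieAlgebra E H) → J = ⊥

end Group

end HomogeneousSpace

end

/-! A competing metric `m'` is diagonalized against the standard one: there is a basis x_i of 𝔭,
orthonormal for -B, in which `m'` has matrix diag(a_i). Let T_ijk be the square of the structure
constant -B([x_i, x_j], x_k); it is symmetric in all three indices. The Killing form gives ∑_ik
T_ijk + 2 C_j = 1, where C_j is the diagonal entry of the Casimir operator at x_j. The standard
metric has Ric(x_j, x_j) = ¼ ∑_ik T_ijk + C_j = ¼ + ½ C_j. Being Einstein therefore forces every C_j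
to equal c, so each row sum of T is d = 1 - 2c. It follows that S = ½ ∑ 1/a_i - ¼ ∑ T_ijk a_k/(a_i
a_j). Put a_i = exp s_i. Equal volume means ∑ s_i = 0, so the terms linear in s cancel and the
quadratic part is ¼ ∑ s_i² - ⅛ ∑ T_ijk (s_k - s_i - s_j)². Symmetry of T and T ≥ 0 bound the last
sum by 5d ∑ s_i². The quadratic part is thus positive definite when 5d < 2, which is c > 3/10. The
basis x depends on `m'`, so the neighbourhood on which the Taylor estimate works must not depend on
T: `exists_pos_forall_diagonal_scalar_ge` provides a radius depending on d alone, and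
`abs_sub_le_of_basis_close` turns closeness in one fixed basis into closeness of all a_i to 1. The
algebra requires 𝔥 to be closed under the bracket. As 𝔥 consists of velocities of curves in H, this
is proved separately (`lie_mem_lieAlgebra`), by writing [X, Y] as a derivative of Ad along a curve.
-/

/-! ### Orthonormal bases and simultaneous diagonalization. -/

section OrthonormalBases

variable {V : Type*} [AddCommGroup V] [Module ℝ V]

theorem repr_eq_of_orthonormal {ι : Type*} [Fintype ι] [DecidableEq ι]
    (m : LinearMap.BilinForm ℝ V) (b : Module.Basis ι ℝ V)
    (hb : ∀ i j, m (b i) (b j) = if i = j then 1 else 0) (v : V) (i : ι) :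
    b.repr v i = m v (b i) := by
  have h := congrArg (fun w => m w (b i)) (b.sum_repr v)
  simp only [map_sum, map_smul, LinearMap.sum_apply, LinearMap.smul_apply, smul_eq_mul, hb,
    mul_ite, mul_one, mul_zero, Finset.sum_ite_eq', Finset.mem_univ,
    if_true] at h
  exact h

theorem trace_eq_sum_of_orthonormal {ι : Type*} [Fintype ι] [DecidableEq ι]
    (m : LinearMap.BilinForm ℝ V) (b : Module.Basis ι ℝ V)
    (hb : ∀ i j, m (b i) (b j) = if i = j then 1 else 0) (f : V →ₗ[ℝ] V) :
    LinearMap.trace ℝ V f = ∑ i, m (f (b i)) (b i) := by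
  rw [LinearMap.trace_eq_matrix_trace ℝ b, Matrix.trace]
  refine Finset.sum_congr rfl fun i _ => ?_
  rw [Matrix.diag_apply, LinearMap.toMatrix_apply, repr_eq_of_orthonormal m b hb]

theorem parseval_of_orthonormal {ι : Type*} [Fintype ι] [DecidableEq ι]
    (m : LinearMap.BilinForm ℝ V) (b : Module.Basis ι ℝ V)
    (hb : ∀ i j, m (b i) (b j) = if i = j then 1 else 0) (u v : V) :
    m u v = ∑ i, m u (b i) * m v (b i) := by
  conv_lhs => rw [← b.sum_repr v]
  simp only [map_sum, map_smul, smul_eq_mul, repr_eq_of_orthonormal m b hb]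
  exact Finset.sum_congr rfl fun i _ => mul_comm _ _

/-- Simultaneous diagonalization of an inner product and a symmetric bilinear form. -/
theorem exists_orthonormal_diagonal [FiniteDimensional ℝ V] (m m' : LinearMap.BilinForm ℝ V)
    (hsymm : ∀ u v, m u v = m v u) (hpos : ∀ v, v ≠ 0 → 0 < m v v)
    (hsymm' : ∀ u v, m' u v = m' v u) :
    ∃ (x : Module.Basis (Fin (Module.finrank ℝ V)) ℝ V) (a : Fin (Module.finrank ℝ V) → ℝ),
      (∀ i j, m (x i) (x j) = if i = j then 1 else 0) ∧
      (∀ i j, m' (x i) (x j) = if i = j then a i else 0) := by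
  have hm : m.Nondegenerate := by
    constructor <;>
    · intro X hX
      by_contra h
      exact (hpos X h).ne' (hX X)
  let core : InnerProductSpace.Core ℝ V :=
    { inner := fun u v => m u v
      conj_inner_symm := fun u v => by simp [hsymm u v]
      re_inner_nonneg := fun v => by
        by_cases h : v = 0
        · simp [h]
        · simpa using (hpos v h).le
      add_left := fun u v w => by simp
      smul_left := fun u v r => by simp
      definite := fun v h => by
        by_contra h'
        exact (hpos v h').ne' h }
  let _ : NormedAddCommGroup V := core.toNormedAddCommGroup
  let _ : InnerProductSpace ℝ V := InnerProductSpace.ofCore core.toCore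
  have hin : ∀ u v : V, inner ℝ u v = m u v := fun u v => rfl
  -- The `m`-self-adjoint operator representing `m'`; the spectral theorem applies to it.
  let T : V →ₗ[ℝ] V := (m.toDual hm).symm.toLinearMap ∘ₗ m'
  have hT : ∀ u v, m (T u) v = m' u v := fun u v => by
    simp [T, LinearMap.BilinForm.apply_toDual_symm_apply]
  have hTs : T.IsSymmetric := fun u v => by
    rw [hin, hin, hT, hsymm, hT, hsymm']
  let b := hTs.eigenvectorBasis rfl
  have hb : ∀ i j, m (b i) (b j) = if i = j then 1 else 0 := fun i j => by
    rw [← hin]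
    exact orthonormal_iff_ite.1 b.orthonormal i j
  refine ⟨b.toBasis, hTs.eigenvalues rfl, fun i j => by simpa using hb i j, fun i j => ?_⟩
  rw [← hT]
  simp only [OrthonormalBasis.coe_toBasis]
  have := hTs.apply_eigenvectorBasis rfl i
  change m (T (b i)) (b j) = _
  rw [this]
  simp only [map_smul, LinearMap.smul_apply, smul_eq_mul]
  change _ * m (b i) (b j) = _
  rw [hb]
  simp

/-- A non-zero vector is a multiple of a member of some orthonormal basis. -/
theorem exists_orthonormal_smul_eq [FiniteDimensional ℝ V] (m : LinearMap.BilinForm ℝ V)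
    (hsymm : ∀ u v, m u v = m v u) (hpos : ∀ v, v ≠ 0 → 0 < m v v) (v : V) (hv : v ≠ 0) :
    ∃ x : Module.Basis (Fin (Module.finrank ℝ V)) ℝ V,
      (∀ i j, m (x i) (x j) = if i = j then 1 else 0) ∧ ∃ j, ∃ r : ℝ, r ≠ 0 ∧ v = r • x j := by
  -- The rank one form m(v, ·) m(v, ·) is diagonalized. Its off-diagonal entries v_i v_j vanish, so
  -- v has only one non-zero coordinate.
  obtain ⟨x, a, hx, ha⟩ := exists_orthonormal_diagonal m
    (LinearMap.mk₂ ℝ (fun u w => m v u * m v w) (by intros; simp; ring) (by intros; simp; ring)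
      (by intros; simp; ring) (by intros; simp; ring)) hsymm hpos
    (fun u w => by simp [mul_comm])
  refine ⟨x, hx, ?_⟩
  have hsum := x.sum_repr v
  obtain ⟨j, hj⟩ : ∃ j, x.repr v j ≠ 0 := by
    by_contra! h
    exact hv (x.repr.map_eq_zero_iff.1 (Finsupp.ext h))
  refine ⟨j, _, hj, ?_⟩
  rw [Finset.sum_eq_single j] at hsum
  · exact hsum.symm
  · intro i _ hij
    have := ha i j
    rw [if_neg hij, LinearMap.mk₂_apply, ← repr_eq_of_orthonormal m x hx,
      ← repr_eq_of_orthonormal m x hx] at this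
    rw [(mul_eq_zero.1 this).resolve_right hj, zero_smul]
  · simp

end OrthonormalBases

/-! ### The Killing form and the splitting 𝔤 = 𝔭 ⊕ 𝔥. -/

namespace HomogeneousSpace

variable {𝔤 : Type*} [LieRing 𝔤] [LieAlgebra ℝ 𝔤]

theorem projP_apply_of_mem {𝔥 : Submodule ℝ 𝔤} (X : 𝔤) (hc : IsCompl (complement 𝔥) 𝔥) :
    X - (projP 𝔥 X : 𝔤) ∈ 𝔥 := by
  rw [projP, dif_pos hc, ← Submodule.projectionOnto_apply_eq_zero_iff hc, map_sub,
    Submodule.projectionOnto_apply_left, sub_self]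

theorem projH_mem {𝔥 : Submodule ℝ 𝔤} (hc : IsCompl (complement 𝔥) 𝔥) (X : 𝔤) :
    projH 𝔥 X ∈ 𝔥 := projP_apply_of_mem X hc

theorem killingForm_symm (X Y : 𝔤) : killingForm ℝ 𝔤 X Y = killingForm ℝ 𝔤 Y X :=
  LieModule.traceForm_comm ℝ 𝔤 𝔤 X Y

theorem killingForm_lie_left (X Y Z : 𝔤) :
    killingForm ℝ 𝔤 ⁅X, Y⁆ Z = killingForm ℝ 𝔤 X ⁅Y, Z⁆ :=
  LieModule.traceForm_apply_lie_apply ℝ 𝔤 𝔤 X Y Z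

theorem killingForm_mem_complement {𝔥 : Submodule ℝ 𝔤} {Z X : 𝔤} (hZ : Z ∈ 𝔥)
    (hX : X ∈ complement 𝔥) : killingForm ℝ 𝔤 Z X = 0 := hX Z hZ

theorem killingForm_projP {𝔥 : Submodule ℝ 𝔤} (hc : IsCompl (complement 𝔥) 𝔥) (X : 𝔤)
    (Y : complement 𝔥) : killingForm ℝ 𝔤 (projP 𝔥 X : 𝔤) Y = killingForm ℝ 𝔤 X Y := by
  have := killingForm_mem_complement (projP_apply_of_mem X hc) Y.2
  rw [map_sub, LinearMap.sub_apply] at this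
  linarith

/-- An orthonormal basis of 𝔥 makes the Killing form nondegenerate on 𝔥, which suffices for the
orthogonal splitting. -/
theorem isCompl_complement [FiniteDimensional ℝ 𝔤] {𝔥 : Submodule ℝ 𝔤} {κ : Type*} [Fintype κ]
    [DecidableEq κ] (z : Module.Basis κ ℝ 𝔥)
    (hz : ∀ i j, -killingForm ℝ 𝔤 (z i) (z j) = if i = j then 1 else 0) :
    IsCompl (complement 𝔥) 𝔥 := by
  refine (LinearMap.BilinForm.isCompl_orthogonal_of_restrict_nondegenerate ?_ ?_).symm
  · intro X Y h
    rw [killingForm_symm, h]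
  · have hb : ∀ i j, (-(LinearMap.BilinForm.restrict (killingForm ℝ 𝔤) 𝔥)) (z i) (z j) =
        if i = j then 1 else 0 := fun i j => hz i j
    have key : ∀ X : 𝔥, (∀ Y : 𝔥, killingForm ℝ 𝔤 X Y = 0) → X = 0 := fun X hX => by
      refine z.repr.map_eq_zero_iff.1 (Finsupp.ext fun i => ?_)
      rw [repr_eq_of_orthonormal _ z hb]
      exact neg_eq_zero.2 (hX (z i))
    exact ⟨fun X hX => key X hX, fun X hX => key X fun Y => by
      rw [killingForm_symm]; exact hX Y⟩

end HomogeneousSpace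

/-! ### Structure constants and the curvature of diagonal metrics. -/

namespace HomogeneousSpace

variable {𝔤 : Type*} [LieRing 𝔤] [LieAlgebra ℝ 𝔤]

/-- The structure constants of a family of vectors with respect to minus the Killing form. -/
noncomputable def structConst {ι κ : Type*} (x : ι → 𝔤) (y : κ → 𝔤) (i j : ι) (k : κ) : ℝ :=
  -killingForm ℝ 𝔤 ⁅x i, x j⁆ (y k)

theorem structConst_swap {ι κ : Type*} (x : ι → 𝔤) (y : κ → 𝔤) (i j : ι) (k : κ) :
    structConst x y j i k = -structConst x y i j k := by
  rw [structConst, structConst, ← lie_skew, map_neg, LinearMap.neg_apply]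

/-- Invariance and symmetry of the Killing form. Together with `structConst_swap` it makes the
squared constants of a single family fully symmetric. -/
theorem structConst_rotate {ι : Type*} (x : ι → 𝔤) (i j k : ι) :
    structConst x x j k i = structConst x x i j k := by
  rw [structConst, structConst, killingForm_lie_left, killingForm_symm, killingForm_lie_left,
    killingForm_lie_left, killingForm_symm, killingForm_lie_left]

section Diagonal

variable {𝔥 : Submodule ℝ 𝔤} (hc : IsCompl (complement 𝔥) 𝔥) {ι : Type*} [Fintype ι]
  [DecidableEq ι] (x : Module.Basis ι ℝ (complement 𝔥))
  (hx : ∀ i j, -killingForm ℝ 𝔤 (x i) (x j) = if i = j then 1 else 0)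

include hx in
theorem repr_complement (Y : complement 𝔥) (i : ι) :
    x.repr Y i = -killingForm ℝ 𝔤 Y (x i) :=
  repr_eq_of_orthonormal (-(LinearMap.BilinForm.restrict (killingForm ℝ 𝔤) (complement 𝔥))) x
    (fun i j => hx i j) Y i

include hc hx in
theorem repr_projP (Y : 𝔤) (i : ι) : x.repr (projP 𝔥 Y) i = -killingForm ℝ 𝔤 Y (x i) := by
  rw [repr_complement x hx, killingForm_projP hc]

include hc hx in
theorem repr_bracketP (i j k : ι) :
    x.repr (bracketP 𝔥 (x i) (x j)) k = structConst (fun i => (x i : 𝔤)) (fun i => x i) i j k :=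
  repr_projP hc x hx _ _

variable {κ : Type*} [Fintype κ] [DecidableEq κ] (z : Module.Basis κ ℝ 𝔥)
  (hz : ∀ i j, -killingForm ℝ 𝔤 (z i) (z j) = if i = j then 1 else 0)

include hc hx hz in
-- With W = [x_i, x_j], invariance turns the coefficient into B(W_𝔥, W) = B(W_𝔥, W_𝔥), which
-- Parseval in 𝔥 expands.
theorem repr_isotropy_term (i j : ι) :
    x.repr (projP 𝔥 ⁅projH 𝔥 ⁅(x i : 𝔤), (x j : 𝔤)⁆, (x j : 𝔤)⁆) i =
      -∑ α, structConst (fun i => (x i : 𝔤)) (fun α => (z α : 𝔤)) i j α ^ 2 := by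
  rw [repr_projP hc x hx, killingForm_lie_left, ← lie_skew (x j : 𝔤) (x i : 𝔤)]
  set W : 𝔤 := ⁅(x i : 𝔤), (x j : 𝔤)⁆
  have hort : ∀ Z : 𝔤, Z ∈ 𝔥 → killingForm ℝ 𝔤 Z W = killingForm ℝ 𝔤 Z (projH 𝔥 W) :=
    fun Z hZ => by
      have := killingForm_mem_complement hZ (projP 𝔥 W).2
      simp [projH, this]
  have hpars := parseval_of_orthonormal
    (-(LinearMap.BilinForm.restrict (killingForm ℝ 𝔤) 𝔥)) z (fun i j => hz i j)
    ⟨projH 𝔥 W, projH_mem hc W⟩ ⟨projH 𝔥 W, projH_mem hc W⟩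
  change -killingForm ℝ 𝔤 (projH 𝔥 W) (projH 𝔥 W) =
    ∑ α, -killingForm ℝ 𝔤 (projH 𝔥 W) (z α) * -killingForm ℝ 𝔤 (projH 𝔥 W) (z α) at hpars
  rw [map_neg, neg_neg, hort _ (projH_mem hc W),
    ← neg_neg (killingForm ℝ 𝔤 (projH 𝔥 W) (projH 𝔥 W)), hpars]
  congr 1
  refine Finset.sum_congr rfl fun α _ => ?_
  rw [structConst, killingForm_symm W, hort _ (z α).2, killingForm_symm]
  ring

variable (m : LinearMap.BilinForm ℝ (complement 𝔥)) (hm : m.Nondegenerate) (a : ι → ℝ)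
  (ha : ∀ i, 0 < a i) (hdiag : ∀ i j, m (x i) (x j) = if i = j then a i else 0)

include hdiag in
theorem form_apply_basis (Y : complement 𝔥) (i : ι) : m Y (x i) = a i * x.repr Y i := by
  have h := congrArg (fun w => m w (x i)) (x.sum_repr Y)
  simp only [map_sum, map_smul, LinearMap.sum_apply, LinearMap.smul_apply, smul_eq_mul, hdiag,
    mul_ite, mul_zero, Finset.sum_ite_eq', Finset.mem_univ, if_true] at h
  rw [← h, mul_comm]

variable [FiniteDimensional ℝ 𝔤]

include hc hx ha hdiag in
theorem repr_leviCivita (i j k : ι) :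
    x.repr (leviCivita 𝔥 m hm (x i) (x j)) k =
      structConst (fun i => (x i : 𝔤)) (fun i => x i) i j k * (a k - a i + a j) / (2 * a k) := by
  have h1 : m (leviCivita 𝔥 m hm (x i) (x j)) (x k) = koszul 𝔥 m (x i) (x j) (x k) :=
    LinearMap.BilinForm.apply_toDual_symm_apply (hB := hm) _ _
  rw [form_apply_basis x m a hdiag] at h1
  have h2 : koszul 𝔥 m (x i) (x j) (x k) = (1 / 2 : ℝ) * (m (bracketP 𝔥 (x i) (x j)) (x k)
      - m (bracketP 𝔥 (x j) (x k)) (x i) + m (bracketP 𝔥 (x k) (x i)) (x j)) := rfl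
  rw [h2] at h1
  simp only [form_apply_basis x m a hdiag, repr_bracketP hc x hx] at h1
  -- Rotation makes all three Koszul terms multiples of the same structure constant.
  rw [structConst_rotate _ i j k, ← structConst_rotate _ k i j] at h1
  have := ha k
  field_simp
  linarith

include hc hx ha hdiag in
theorem repr_leviCivita_left (i j : ι) (Y : complement 𝔥) :
    x.repr (leviCivita 𝔥 m hm (x i) Y) j = ∑ k, x.repr Y k *
      (structConst (fun i => (x i : 𝔤)) (fun i => x i) i k j * (a j - a i + a k) / (2 * a j)) := by
  have h := congrArg (fun w => x.repr (leviCivita 𝔥 m hm (x i) w) j) (x.sum_repr Y)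
  simp only [map_sum, map_smul, Finsupp.coe_finsetSum, Finset.sum_apply, Finsupp.smul_apply,
    smul_eq_mul, repr_leviCivita hc x hx m hm a ha hdiag] at h
  exact h.symm

include hc hx ha hdiag in
theorem repr_leviCivita_right (i j : ι) (Y : complement 𝔥) :
    x.repr (leviCivita 𝔥 m hm Y (x i)) j = ∑ k, x.repr Y k *
      (structConst (fun i => (x i : 𝔤)) (fun i => x i) k i j * (a j - a k + a i) / (2 * a j)) := by
  have h := congrArg (fun w => x.repr (leviCivita 𝔥 m hm w (x i)) j) (x.sum_repr Y)
  simp only [map_sum, map_smul, LinearMap.sum_apply, LinearMap.smul_apply, Finsupp.coe_finsetSum,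
    Finset.sum_apply, Finsupp.smul_apply,
    smul_eq_mul, repr_leviCivita hc x hx m hm a ha hdiag] at h
  exact h.symm

include hc hx ha hdiag hz in
/-- The Ricci curvature of a diagonal metric. -/
theorem ricci_diagonal (j : ι) :
    ricci 𝔥 m hm (x j) (x j) =
      ∑ i, ∑ k, structConst (fun i => (x i : 𝔤)) (fun i => x i) i j k ^ 2 *
        ((a i - a k + a j) / (2 * a i) - (a k ^ 2 - (a i - a j) ^ 2) / (4 * a k * a i)) +
      ∑ i, ∑ α, structConst (fun i => (x i : 𝔤)) (fun α => (z α : 𝔤)) i j α ^ 2 := by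
  have h0 : ricci 𝔥 m hm (x j) (x j) =
      LinearMap.trace ℝ (complement 𝔥) (curvature 𝔥 m hm (x j) (x j)) := rfl
  rw [h0, LinearMap.trace_eq_matrix_trace ℝ x, Matrix.trace, ← Finset.sum_add_distrib]
  refine Finset.sum_congr rfl fun i _ => ?_
  rw [Matrix.diag_apply, LinearMap.toMatrix_apply]
  have h1 : curvature 𝔥 m hm (x j) (x j) (x i) =
      leviCivita 𝔥 m hm (x i) (leviCivita 𝔥 m hm (x j) (x j))
      - leviCivita 𝔥 m hm (x j) (leviCivita 𝔥 m hm (x i) (x j))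
      - leviCivita 𝔥 m hm (bracketP 𝔥 (x i) (x j)) (x j)
      - projP 𝔥 ⁅projH 𝔥 ⁅(x i : 𝔤), (x j : 𝔤)⁆, (x j : 𝔤)⁆ := rfl
  -- Since [x_j, x_j] = 0, also Λ(x_j)x_j = 0, and the first curvature term drops out.
  have hself : ∀ k, structConst (fun i => (x i : 𝔤)) (fun i => (x i : 𝔤)) j j k = 0 := fun k => by
    simp [structConst]
  rw [h1]
  simp only [map_sub, Finsupp.sub_apply, repr_isotropy_term hc x hx z hz,
    repr_leviCivita_left hc x hx m hm a ha hdiag (i := i) (Y := leviCivita 𝔥 m hm (x j) (x j)),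
    repr_leviCivita_left hc x hx m hm a ha hdiag (i := j) (Y := leviCivita 𝔥 m hm (x i) (x j)),
    repr_leviCivita_right hc x hx m hm a ha hdiag j i (bracketP 𝔥 (x i) (x j)),
    repr_bracketP hc x hx]
  simp only [repr_leviCivita hc x hx m hm a ha hdiag, hself, zero_mul, zero_div,
    Finset.sum_const_zero, zero_sub, sub_neg_eq_add]
  congr 1
  rw [← Finset.sum_neg_distrib, ← Finset.sum_sub_distrib]
  refine Finset.sum_congr rfl fun k _ => ?_
  rw [structConst_rotate _ i j k, structConst_swap _ _ j k i, structConst_rotate _ i j k]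
  have h1 := ha i
  have h2 := ha k
  field_simp
  ring

include ha hdiag in
theorem scalar_eq_sum_ricci :
    scalar 𝔥 m hm = ∑ j, ricci 𝔥 m hm (x j) (x j) / a j := by
  rw [scalar, LinearMap.trace_eq_matrix_trace ℝ x, Matrix.trace]
  refine Finset.sum_congr rfl fun j _ => ?_
  rw [Matrix.diag_apply, LinearMap.toMatrix_apply]
  have h1 : m ((m.toDual hm).symm (ricci 𝔥 m hm (x j))) (x j) = ricci 𝔥 m hm (x j) (x j) :=
    LinearMap.BilinForm.apply_toDual_symm_apply (hB := hm) _ _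
  rw [form_apply_basis x m a hdiag] at h1
  rw [← h1]
  have := ha j
  field_simp
  rfl

end Diagonal

/-- Contraction of a weight with a totally symmetric array. -/
theorem sum_symmetric_weight {ι : Type*} [Fintype ι] (T : ι → ι → ι → ℝ)
    (hr : ∀ i j k, T j k i = T i j k) (a : ι → ℝ)
    (ha : ∀ i, 0 < a i) :
    ∑ j, (∑ i, ∑ k, T i j k *
      ((a i - a k + a j) / (2 * a i) - (a k ^ 2 - (a i - a j) ^ 2) / (4 * a k * a i))) / a j =
    (1 / 2) * ∑ i, (∑ j, ∑ k, T j k i) / a i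
      - (1 / 4) * ∑ i, ∑ j, ∑ k, T i j k * (a k / (a i * a j)) := by
  set P : ι → ι → ι → ℝ := fun i j k => T i j k / a i with hP
  set Q : ι → ι → ι → ℝ := fun i j k => T i j k * (a k / (a i * a j)) with hQ
  -- The weight splits into cyclic rotations of P and Q, which have equal total sums. The
  -- coefficients add up to ½ for P and -¼ for Q.
  have e : ∀ i j k, T i j k *
      ((a i - a k + a j) / (2 * a i) - (a k ^ 2 - (a i - a j) ^ 2) / (4 * a k * a i)) / a j =
      1 / 2 * P j k i + 1 / 2 * P i j k - 1 / 2 * Q i j k - 1 / 4 * Q i j k + 1 / 4 * Q j k i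
        + 1 / 4 * Q k i j - 1 / 2 * P k i j := fun i j k => by
    have h1 := ha i
    have h2 := ha j
    have h3 := ha k
    simp only [hP, hQ, hr i j k, ← hr k i j]
    field_simp
    ring
  have s1 : ∀ f : ι → ι → ι → ℝ, ∑ j, ∑ i, ∑ k, f i j k = ∑ i, ∑ j, ∑ k, f i j k := fun f =>
    Finset.sum_comm
  have s2 : ∀ f : ι → ι → ι → ℝ, ∑ i, ∑ j, ∑ k, f j k i = ∑ i, ∑ j, ∑ k, f i j k := fun f => by
    rw [Finset.sum_comm]
    exact Finset.sum_congr rfl fun _ _ => Finset.sum_comm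
  have s3 : ∀ f : ι → ι → ι → ℝ, ∑ i, ∑ j, ∑ k, f k i j = ∑ i, ∑ j, ∑ k, f i j k := fun f => by
    rw [← s2 (fun i j k => f k i j)]
  have hPsum : ∑ i, (∑ j, ∑ k, T j k i) / a i = ∑ i, ∑ j, ∑ k, P i j k := by
    refine Finset.sum_congr rfl fun i _ => ?_
    simp only [hP, Finset.sum_div, hr i]
  rw [hPsum]
  simp only [Finset.sum_div, e]
  rw [s1]
  simp only [Finset.sum_add_distrib, Finset.sum_sub_distrib, ← Finset.mul_sum]
  rw [s2 P, s2 Q, s3 P, s3 Q]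
  ring

end HomogeneousSpace

/-! ### Consequences of the Einstein condition. -/

namespace HomogeneousSpace

section Einstein

variable {𝔤 : Type*} [LieRing 𝔤] [LieAlgebra ℝ 𝔤] [FiniteDimensional ℝ 𝔤]
  {𝔥 : Submodule ℝ 𝔤} {ι κ : Type*} [Fintype ι] [DecidableEq ι] [Fintype κ] [DecidableEq κ]
  (hsub : ∀ X ∈ 𝔥, ∀ Y ∈ 𝔥, ⁅X, Y⁆ ∈ 𝔥)
  (z : Module.Basis κ ℝ 𝔥)
  (hz : ∀ i j, -killingForm ℝ 𝔤 (z i) (z j) = if i = j then 1 else 0)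

section Basis

variable (x : Module.Basis ι ℝ (complement 𝔥))
  (hx : ∀ i j, -killingForm ℝ 𝔤 (x i) (x j) = if i = j then 1 else 0)

include hz hx in
-- -B(X, X) = -tr(ad X)² is the sum of the squared lengths of [X, b_u] over an orthonormal basis b
-- of 𝔤 adapted to 𝔭 ⊕ 𝔥; the four sums are the four blocks of ad X.
theorem killingForm_self_eq_sum (X : 𝔤) :
    -killingForm ℝ 𝔤 X X =
      (∑ i, ∑ k, killingForm ℝ 𝔤 ⁅X, (x i : 𝔤)⁆ (x k) ^ 2 +
        ∑ i, ∑ α, killingForm ℝ 𝔤 ⁅X, (x i : 𝔤)⁆ (z α) ^ 2) +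
      (∑ α, ∑ i, killingForm ℝ 𝔤 ⁅X, (z α : 𝔤)⁆ (x i) ^ 2 +
        ∑ α, ∑ γ, killingForm ℝ 𝔤 ⁅X, (z α : 𝔤)⁆ (z γ) ^ 2) := by
  have hc := isCompl_complement z hz
  let b : Module.Basis (ι ⊕ κ) ℝ 𝔤 :=
    (x.prod z).map (Submodule.prodEquivOfIsCompl (complement 𝔥) 𝔥 hc)
  have hbl : ∀ i, b (Sum.inl i) = x i := fun i => by simp [b]
  have hbr : ∀ α, b (Sum.inr α) = z α := fun i => by simp [b]
  have hb : ∀ u v, (-killingForm ℝ 𝔤) (b u) (b v) = if u = v then 1 else 0 := by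
    rintro (i | α) (j | γ)
    · rw [hbl, hbl, LinearMap.neg_apply, LinearMap.neg_apply, hx]; simp
    · rw [hbl, hbr, LinearMap.neg_apply, LinearMap.neg_apply, killingForm_symm,
        killingForm_mem_complement (z γ).2 (x i).2]; simp
    · rw [hbl, hbr, LinearMap.neg_apply, LinearMap.neg_apply,
        killingForm_mem_complement (z α).2 (x j).2]; simp
    · rw [hbr, hbr, LinearMap.neg_apply, LinearMap.neg_apply, hz]; simp
  have h1 : killingForm ℝ 𝔤 X X = -∑ u, ∑ v, killingForm ℝ 𝔤 ⁅X, b u⁆ (b v) ^ 2 := by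
    rw [killingForm_apply_apply, trace_eq_sum_of_orthonormal (-killingForm ℝ 𝔤) b hb,
      ← Finset.sum_neg_distrib]
    refine Finset.sum_congr rfl fun u _ => ?_
    have h2 := parseval_of_orthonormal (-killingForm ℝ 𝔤) b hb ⁅X, b u⁆ ⁅X, b u⁆
    simp only [LinearMap.neg_apply] at h2
    have h3 : killingForm ℝ 𝔤 ⁅X, ⁅X, b u⁆⁆ (b u) = -killingForm ℝ 𝔤 ⁅X, b u⁆ ⁅X, b u⁆ := by
      rw [← lie_skew, map_neg, LinearMap.neg_apply, killingForm_lie_left]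
    simp only [LinearMap.comp_apply, LieAlgebra.ad_apply, LinearMap.neg_apply, h3]
    rw [h2, ← Finset.sum_neg_distrib, ← Finset.sum_neg_distrib]
    exact Finset.sum_congr rfl fun v _ => by ring
  rw [h1, neg_neg]
  simp only [Fintype.sum_sum_type, hbl, hbr, Finset.sum_add_distrib]
  ring

omit [FiniteDimensional ℝ 𝔤] [Fintype ι] [DecidableEq ι] [Fintype κ] [DecidableEq κ] in
theorem sq_killingForm_lie_basis (j i : ι) (α : κ) :
    killingForm ℝ 𝔤 ⁅(x j : 𝔤), (z α : 𝔤)⁆ (x i) ^ 2 =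
      structConst (fun i => (x i : 𝔤)) (fun α => (z α : 𝔤)) i j α ^ 2 := by
  rw [killingForm_symm, ← killingForm_lie_left, structConst, neg_sq]

include hsub hz hx in
-- Expand -B(x_j, x_j) = 1 in blocks. The two mixed blocks agree, whence the factor 2, and the 𝔥𝔥
-- block vanishes because [𝔥, 𝔥] ⊂ 𝔥 is orthogonal to x_j.
theorem sum_structConst_sq (j : ι) :
    ∑ i, ∑ k, structConst (fun i => (x i : 𝔤)) (fun i => x i) i j k ^ 2 +
      2 * ∑ i, ∑ α, structConst (fun i => (x i : 𝔤)) (fun α => (z α : 𝔤)) i j α ^ 2 = 1 := by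
  have h := killingForm_self_eq_sum z hz x hx (x j)
  rw [hx, if_pos rfl] at h
  have h0 : ∀ α γ, killingForm ℝ 𝔤 ⁅(x j : 𝔤), (z α : 𝔤)⁆ (z γ) = 0 := fun α γ => by
    rw [killingForm_lie_left, killingForm_symm,
      killingForm_mem_complement (hsub _ (z α).2 _ (z γ).2) (x j).2]
  have h1 : ∀ i k, killingForm ℝ 𝔤 ⁅(x j : 𝔤), (x i : 𝔤)⁆ (x k) ^ 2 =
      structConst (fun i => (x i : 𝔤)) (fun i => x i) i j k ^ 2 := fun i k => by
    rw [structConst_swap, neg_sq, structConst, neg_sq]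
  have h2 : ∀ i α, killingForm ℝ 𝔤 ⁅(x j : 𝔤), (x i : 𝔤)⁆ (z α) ^ 2 =
      structConst (fun i => (x i : 𝔤)) (fun α => (z α : 𝔤)) i j α ^ 2 := fun i α => by
    rw [structConst_swap, neg_sq, structConst, neg_sq]
  simp only [h0, h1, h2, sq_killingForm_lie_basis] at h
  rw [Finset.sum_comm (s := (Finset.univ : Finset κ))] at h
  simp at h
  linarith

omit [FiniteDimensional ℝ 𝔤] [DecidableEq κ] in
include hsub hx in
-- Pairing the Casimir operator with x_j gives ∑ |[z_α, x_j]|². These brackets stay in 𝔭 because ad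
-- 𝔥 preserves 𝔭, so Parseval in x applies.
theorem sum_isotropy_sq_eq_of_casimir (c : ℝ) (j : ι)
    (hcas : -∑ α, ⁅(z α : 𝔤), ⁅(z α : 𝔤), (x j : 𝔤)⁆⁆ = c • (x j : 𝔤)) :
    ∑ i, ∑ α, structConst (fun i => (x i : 𝔤)) (fun α => (z α : 𝔤)) i j α ^ 2 = c := by
  have h := congrArg (fun w => -killingForm ℝ 𝔤 w (x j)) hcas
  simp only [map_neg, map_sum, map_smul, LinearMap.neg_apply, LinearMap.sum_apply,
    LinearMap.smul_apply, smul_eq_mul, neg_neg] at h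
  rw [← mul_neg, hx, if_pos rfl, mul_one] at h
  rw [← h, Finset.sum_comm]
  refine Finset.sum_congr rfl fun α _ => ?_
  have hmem : ⁅(x j : 𝔤), (z α : 𝔤)⁆ ∈ complement 𝔥 := fun Z hZ => by
    change killingForm ℝ 𝔤 Z _ = 0
    rw [killingForm_symm, killingForm_lie_left, killingForm_symm,
      killingForm_mem_complement (hsub _ (z α).2 _ hZ) (x j).2]
  have hpars := parseval_of_orthonormal
    (-(LinearMap.BilinForm.restrict (killingForm ℝ 𝔤) (complement 𝔥))) x (fun i j => hx i j)
    ⟨_, hmem⟩ ⟨_, hmem⟩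
  change -killingForm ℝ 𝔤 ⁅(x j : 𝔤), (z α : 𝔤)⁆ ⁅(x j : 𝔤), (z α : 𝔤)⁆ =
    ∑ i, -killingForm ℝ 𝔤 ⁅(x j : 𝔤), (z α : 𝔤)⁆ (x i) *
      -killingForm ℝ 𝔤 ⁅(x j : 𝔤), (z α : 𝔤)⁆ (x i) at hpars
  have h3 : killingForm ℝ 𝔤 ⁅(z α : 𝔤), ⁅(z α : 𝔤), (x j : 𝔤)⁆⁆ (x j) =
      -killingForm ℝ 𝔤 ⁅(x j : 𝔤), (z α : 𝔤)⁆ ⁅(x j : 𝔤), (z α : 𝔤)⁆ := by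
    rw [← lie_skew (z α : 𝔤) ⁅(z α : 𝔤), (x j : 𝔤)⁆, map_neg, LinearMap.neg_apply,
      killingForm_lie_left, ← lie_skew (z α : 𝔤) (x j : 𝔤), map_neg, map_neg, LinearMap.neg_apply,
      neg_neg]
  rw [h3, hpars]
  refine Finset.sum_congr rfl fun i _ => ?_
  rw [← sq_killingForm_lie_basis]
  ring

include hz hx in
/-- The Ricci curvature of the standard metric. -/
theorem ricci_standard (m : LinearMap.BilinForm ℝ (complement 𝔥)) (hm : m.Nondegenerate)
    (hstd : ∀ X Y : complement 𝔥, m X Y = -killingForm ℝ 𝔤 X Y) (j : ι) :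
    ricci 𝔥 m hm (x j) (x j) =
      (1 / 4) * ∑ i, ∑ k, structConst (fun i => (x i : 𝔤)) (fun i => x i) i j k ^ 2 +
      ∑ i, ∑ α, structConst (fun i => (x i : 𝔤)) (fun α => (z α : 𝔤)) i j α ^ 2 := by
  rw [ricci_diagonal (isCompl_complement z hz) x hx z hz m hm (fun _ => 1)
    (fun _ => one_pos) (fun i j => by rw [hstd, hx])]
  congr 1
  simp only [Finset.mul_sum]
  refine Finset.sum_congr rfl fun i _ => Finset.sum_congr rfl fun k _ => by ring

end Basis

include hsub hz in
/-- For a standard Einstein metric the Casimir operator of the isotropy representation is scalar: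
its trace against every orthonormal basis is the Casimir constant. -/
theorem sum_structConst_sq_of_einstein (m : LinearMap.BilinForm ℝ (complement 𝔥))
    (hm : m.Nondegenerate) (hstd : ∀ X Y : complement 𝔥, m X Y = -killingForm ℝ 𝔤 X Y)
    (hpos : ∀ X, X ≠ 0 → 0 < m X X) (r : ℝ) (hein : ∀ X Y, ricci 𝔥 m hm X Y = r * m X Y)
    (c : ℝ) (X : 𝔤) (hX : X ∈ complement 𝔥) (hX0 : X ≠ 0)
    (hcas : -∑ α, ⁅(z α : 𝔤), ⁅(z α : 𝔤), X⁆⁆ = c • X)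
    (x : Module.Basis ι ℝ (complement 𝔥))
    (hx : ∀ i j, -killingForm ℝ 𝔤 (x i) (x j) = if i = j then 1 else 0) (j : ι) :
    ∑ i, ∑ k, structConst (fun i => (x i : 𝔤)) (fun i => x i) i j k ^ 2 = 1 - 2 * c ∧
    ∑ i, ∑ α, structConst (fun i => (x i : 𝔤)) (fun α => (z α : 𝔤)) i j α ^ 2 = c := by
  -- The eigenvalue c is given at the single vector X, so an auxiliary basis containing a multiple
  -- of X is needed to identify r.
  obtain ⟨y, hy, l, s, hs, hXs⟩ := exists_orthonormal_smul_eq m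
    (fun u v => by rw [hstd, hstd, killingForm_symm]) hpos (⟨X, hX⟩ : complement 𝔥)
    (fun h => hX0 (congrArg Subtype.val h))
  have hy' : ∀ i j, -killingForm ℝ 𝔤 (y i) (y j) = if i = j then 1 else 0 := fun i j => by
    rw [← hstd, hy]
  have hcasy : -∑ α, ⁅(z α : 𝔤), ⁅(z α : 𝔤), (y l : 𝔤)⁆⁆ = c • (y l : 𝔤) := by
    have hXs' : X = s • (y l : 𝔤) := congrArg Subtype.val hXs
    rw [hXs', smul_comm] at hcas
    simp only [lie_smul, ← Finset.smul_sum, ← smul_neg] at hcas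
    exact smul_right_injective 𝔤 hs hcas
  have e1 := ricci_standard z hz y hy' m hm hstd l
  have e2 := ricci_standard z hz x hx m hm hstd j
  have k1 := sum_structConst_sq hsub z hz y hy' l
  have k2 := sum_structConst_sq hsub z hz x hx j
  have c1 := sum_isotropy_sq_eq_of_casimir hsub z y hy' c l hcasy
  rw [hein, hstd, hy', if_pos rfl] at e1
  rw [hein, hstd, hx, if_pos rfl] at e2
  -- In either basis r = ¼ + ½ C_j. At y_l this reads r = ¼ + ½ c, so C_j = c for the basis x as
  -- well.
  constructor <;> linarith

include hsub hz in
/-- The scalar curvature of a metric which is diagonal in an orthonormal basis of a standard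
Einstein metric. -/
theorem scalar_diagonal_of_einstein (c : ℝ) (x : Module.Basis ι ℝ (complement 𝔥))
    (hx : ∀ i j, -killingForm ℝ 𝔤 (x i) (x j) = if i = j then 1 else 0)
    (hT : ∀ j, ∑ i, ∑ k, structConst (fun i => (x i : 𝔤)) (fun i => x i) i j k ^ 2 = 1 - 2 * c)
    (m' : LinearMap.BilinForm ℝ (complement 𝔥)) (hm' : m'.Nondegenerate) (a : ι → ℝ)
    (ha : ∀ i, 0 < a i) (hdiag : ∀ i j, m' (x i) (x j) = if i = j then a i else 0) :
    scalar 𝔥 m' hm' = (1 / 2) * ∑ i, 1 / a i - (1 / 4) * ∑ i, ∑ j, ∑ k,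
      structConst (fun i => (x i : 𝔤)) (fun i => x i) i j k ^ 2 * (a k / (a i * a j)) := by
  have hh : ∀ j, ∑ i, ∑ α, structConst (fun i => (x i : 𝔤)) (fun α => (z α : 𝔤)) i j α ^ 2 = c :=
    fun j => by linarith [hT j, sum_structConst_sq hsub z hz x hx j]
  have hrot : ∀ i j k, structConst (fun i => (x i : 𝔤)) (fun i => (x i : 𝔤)) j k i ^ 2 =
    structConst (fun i => (x i : 𝔤)) (fun i => (x i : 𝔤)) i j k ^ 2 := fun i j k => by
      rw [structConst_rotate]
  have hT' : ∀ i, ∑ j, ∑ k, structConst (fun i => (x i : 𝔤)) (fun i => (x i : 𝔤)) j k i ^ 2 =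
      1 - 2 * c := fun i => by
    rw [← hT i]
    refine Finset.sum_congr rfl fun j _ => Finset.sum_congr rfl fun k _ => ?_
    rw [structConst_rotate (fun i => (x i : 𝔤)) i j k, structConst_swap, neg_sq]
  rw [scalar_eq_sum_ricci x m' hm' a ha hdiag]
  simp only [ricci_diagonal (isCompl_complement z hz) x hx z hz m' hm' a ha hdiag, hh]
  simp only [add_div _ c, Finset.sum_add_distrib]
  rw [sum_symmetric_weight _ hrot a ha]
  simp only [hT']
  -- The coefficient (1 - 2c)/2 from 𝔭 and the isotropy coefficient c of ∑ 1/a_i add up to ½.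
  simp only [div_eq_mul_one_div (1 - 2 * c), div_eq_mul_one_div c, ← Finset.mul_sum]
  ring

end Einstein

end HomogeneousSpace

/-! ### The second variation estimate. -/

section SecondVariation

/-- The Taylor remainder is at most (2/9)|u|³, which |u| ≤ ε absorbs into (ε/2)u². -/
theorem exp_le_quadratic {ε u : ℝ} (hε : ε ≤ 1) (hu : |u| ≤ ε) :
    Real.exp u ≤ 1 + u + (1 + ε) / 2 * u ^ 2 ∧ 1 + u + (1 - ε) / 2 * u ^ 2 ≤ Real.exp u := by
  have h := Real.exp_bound (hu.trans hε) (n := 3) (by norm_num)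
  norm_num [Finset.sum_range_succ, Nat.factorial] at h
  have h3 : |u| ^ 3 * (2 / 9) ≤ ε / 2 * u ^ 2 := by
    have : |u| ^ 3 = |u| * u ^ 2 := by rw [← sq_abs u]; ring
    rw [this]
    nlinarith [mul_le_mul_of_nonneg_right hu (sq_nonneg u), mul_nonneg (abs_nonneg u) (sq_nonneg u)]
  rw [abs_le] at h
  constructor <;> linarith [h.1, h.2]

variable {ι : Type*} [Fintype ι] (T : ι → ι → ι → ℝ) (hr : ∀ i j k, T j k i = T i j k)

include hr in
theorem sum_rotate (g : ι → ι → ι → ℝ) :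
    ∑ i, ∑ j, ∑ k, T i j k * g j k i = ∑ i, ∑ j, ∑ k, T i j k * g i j k := by
  have h : ∀ f : ι → ι → ι → ℝ, ∑ i, ∑ j, ∑ k, f j k i = ∑ i, ∑ j, ∑ k, f i j k := fun f => by
    rw [Finset.sum_comm]
    exact Finset.sum_congr rfl fun _ _ => Finset.sum_comm
  rw [← h (fun i j k => T i j k * g i j k)]
  simp only [hr]

variable (hT0 : ∀ i j k, 0 ≤ T i j k) (d : ℝ) (hT : ∀ i, ∑ j, ∑ k, T i j k = d)

include hT in
theorem sum_weight_fst (g : ι → ℝ) : ∑ i, ∑ j, ∑ k, T i j k * g i = d * ∑ i, g i := by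
  simp only [← Finset.sum_mul, hT, ← Finset.mul_sum]

include hr hT in
theorem sum_weight_thd (g : ι → ℝ) : ∑ i, ∑ j, ∑ k, T i j k * g k = d * ∑ i, g i := by
  rw [← sum_weight_fst T d hT, ← sum_rotate T hr fun i j k => g k]

include hr hT in
theorem sum_weight_snd (g : ι → ℝ) : ∑ i, ∑ j, ∑ k, T i j k * g j = d * ∑ i, g i := by
  rw [← sum_weight_thd T hr d hT, ← sum_rotate T hr fun i j k => g j]

include hr hT0 hT in
-- The square terms give 3d ∑ s_i². By cyclic symmetry all mixed sums equal M = ∑ T_ijk s_i s_j and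
-- leave -2M, while ∑ T_ijk (s_i + s_j)² ≥ 0 gives -2M ≤ 2d ∑ s_i².
theorem sum_weight_sq_le (s : ι → ℝ) :
    ∑ i, ∑ j, ∑ k, T i j k * (s k - s i - s j) ^ 2 ≤ 5 * d * ∑ i, s i ^ 2 := by
  have h1 := sum_weight_fst T d hT fun i => s i ^ 2
  have h2 := sum_weight_snd T hr d hT fun i => s i ^ 2
  have h3 := sum_weight_thd T hr d hT fun i => s i ^ 2
  have h4 := sum_rotate T hr fun i j _ => s i * s j
  have h5 := sum_rotate T hr fun i _ k => s k * s i
  have h6 : ∑ i, ∑ j, ∑ k, T i j k * (s k - s i - s j) ^ 2 =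
      ∑ i, ∑ j, ∑ k, T i j k * s i ^ 2 + ∑ i, ∑ j, ∑ k, T i j k * s j ^ 2 +
      ∑ i, ∑ j, ∑ k, T i j k * s k ^ 2 + 2 * ∑ i, ∑ j, ∑ k, T i j k * (s i * s j) -
      2 * ∑ i, ∑ j, ∑ k, T i j k * (s k * s i) - 2 * ∑ i, ∑ j, ∑ k, T i j k * (s j * s k) := by
    simp only [Finset.mul_sum, ← Finset.sum_add_distrib, ← Finset.sum_sub_distrib]
    refine Finset.sum_congr rfl fun i _ => Finset.sum_congr rfl fun j _ =>
      Finset.sum_congr rfl fun k _ => by ring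
  have h7 : 0 ≤ ∑ i, ∑ j, ∑ k, T i j k * s i ^ 2 + ∑ i, ∑ j, ∑ k, T i j k * s j ^ 2 +
      2 * ∑ i, ∑ j, ∑ k, T i j k * (s i * s j) := by
    simp only [Finset.mul_sum, ← Finset.sum_add_distrib]
    refine Finset.sum_nonneg fun i _ => Finset.sum_nonneg fun j _ => Finset.sum_nonneg fun k _ => ?_
    have := mul_nonneg (hT0 i j k) (sq_nonneg (s i + s j))
    linarith
  linarith

include hr hT0 hT in
-- Second-order expansion in logarithmic coordinates: the first sum gains (1 - ε)/4 · ∑ s_i², the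
-- second costs at most 5d(1 + ε)/8 · ∑ s_i², and `hεd` compares the two. The bound ε/3 on each s_i
-- keeps |s_k - s_i - s_j| below ε.
theorem exp_scalar_ge {ε : ℝ} (hε : ε ≤ 1)
    (hεd : (1 + ε) * (5 * d) ≤ (1 - ε) * 2) (s : ι → ℝ) (hs : ∀ i, |s i| ≤ ε / 3)
    (hsum : ∑ i, s i = 0) :
    Fintype.card ι / 2 - Fintype.card ι * d / 4 ≤ (1 / 2) * ∑ i, Real.exp (-s i) -
      (1 / 4) * ∑ i, ∑ j, ∑ k, T i j k * Real.exp (s k - s i - s j) := by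
  -- The sign of ε can be read off `hs` only when an index exists; the empty case is treated apart.
  have hε0 : ∀ _ : ι, 0 ≤ ε := fun i => by linarith [abs_nonneg (s i), hs i]
  have h1 : (Fintype.card ι : ℝ) + (1 - ε) / 2 * ∑ i, s i ^ 2 ≤ ∑ i, Real.exp (-s i) := by
    have : (Fintype.card ι : ℝ) + (1 - ε) / 2 * ∑ i, s i ^ 2 =
        ∑ i, (1 + -s i + (1 - ε) / 2 * (-s i) ^ 2) := by
      simp only [Finset.sum_add_distrib, Finset.sum_neg_distrib, hsum, neg_sq, ← Finset.mul_sum]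
      simp
    rw [this]
    exact Finset.sum_le_sum fun i _ => (exp_le_quadratic hε
      (by rw [abs_neg]; linarith [hs i, hε0 i])).2
  have h2 : ∑ i, ∑ j, ∑ k, T i j k * Real.exp (s k - s i - s j) ≤ Fintype.card ι * d +
      (1 + ε) / 2 * ∑ i, ∑ j, ∑ k, T i j k * (s k - s i - s j) ^ 2 := by
    have e1 := sum_weight_fst T d hT s
    have e2 := sum_weight_snd T hr d hT s
    have e3 := sum_weight_thd T hr d hT s
    rw [hsum, mul_zero] at e1 e2 e3
    have e4 : ∑ i, ∑ j, ∑ k, T i j k = Fintype.card ι * d := by simp [hT]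
    have : Fintype.card ι * d +
        (1 + ε) / 2 * ∑ i, ∑ j, ∑ k, T i j k * (s k - s i - s j) ^ 2 =
        ∑ i, ∑ j, ∑ k, T i j k * (1 + (s k - s i - s j) + (1 + ε) / 2 * (s k - s i - s j) ^ 2) := by
      have e5 : ∑ i, ∑ j, ∑ k, T i j k *
            (1 + (s k - s i - s j) + (1 + ε) / 2 * (s k - s i - s j) ^ 2) =
          ∑ i, ∑ j, ∑ k, T i j k + ∑ i, ∑ j, ∑ k, T i j k * s k - ∑ i, ∑ j, ∑ k, T i j k * s i -
          ∑ i, ∑ j, ∑ k, T i j k * s j +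
          (1 + ε) / 2 * ∑ i, ∑ j, ∑ k, T i j k * (s k - s i - s j) ^ 2 := by
        simp only [Finset.mul_sum, ← Finset.sum_add_distrib, ← Finset.sum_sub_distrib]
        refine Finset.sum_congr rfl fun i _ => Finset.sum_congr rfl fun j _ =>
          Finset.sum_congr rfl fun k _ => by ring
      rw [e5, e1, e2, e3, e4]
      ring
    rw [this]
    refine Finset.sum_le_sum fun i _ => Finset.sum_le_sum fun j _ => Finset.sum_le_sum fun k _ =>
      mul_le_mul_of_nonneg_left (exp_le_quadratic hε ?_).1 (hT0 i j k)
    have a1 := abs_le.1 (hs i)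
    have a2 := abs_le.1 (hs j)
    have a3 := abs_le.1 (hs k)
    rw [abs_le]
    constructor <;> linarith [a1.1, a1.2, a2.1, a2.2, a3.1, a3.2]
  have h3 := sum_weight_sq_le T hr hT0 d hT s
  have hS : 0 ≤ ∑ i, s i ^ 2 := Finset.sum_nonneg fun i _ => sq_nonneg _
  rcases isEmpty_or_nonempty ι with hι | ⟨⟨i⟩⟩
  · simp
  have h4 := mul_le_mul_of_nonneg_left h3 (show 0 ≤ (1 + ε) / 8 by linarith [hε0 i])
  have h5 := mul_le_mul_of_nonneg_right hεd hS
  linarith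

end SecondVariation

/-- The scalar curvature of diagonal metrics of unit volume has a local minimum at the standard
one, uniformly in the structure constants. -/
theorem exists_pos_forall_diagonal_scalar_ge (d : ℝ) (hd0 : 0 ≤ d) (hd : 5 * d < 2) :
    ∃ δ > 0, ∀ {ι : Type} [Fintype ι] (T : ι → ι → ι → ℝ) (a : ι → ℝ),
      (∀ i j k, T j k i = T i j k) → (∀ i j k, 0 ≤ T i j k) → (∀ i, ∑ j, ∑ k, T i j k = d) →
      (∀ i, 0 < a i) → (∀ i, |a i - 1| < δ) → ∏ i, a i = 1 →
      Fintype.card ι / 2 - Fintype.card ι * d / 4 ≤ (1 / 2) * ∑ i, 1 / a i -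
        (1 / 4) * ∑ i, ∑ j, ∑ k, T i j k * (a k / (a i * a j)) := by
  -- The requirement is ε(2 + 5d) ≤ 2 - 5d; since 2 + 5d < 4, a quarter of the right-hand side will
  -- do.
  set ε : ℝ := (2 - 5 * d) / 4 with hε
  have hε0 : 0 < ε := by rw [hε]; linarith
  obtain ⟨δ, hδ, hlog⟩ := Metric.continuousAt_iff.1
    (Real.continuousAt_log one_ne_zero) (ε / 3) (by positivity)
  refine ⟨δ, hδ, fun {ι} _ T a hr hT0 hT ha hclose hprod => ?_⟩
  have h := exp_scalar_ge T hr hT0 d hT (ε := ε) (by linarith) (by nlinarith)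
    (fun i => Real.log (a i)) (fun i => by
      have := hlog (x := a i) (by rw [Real.dist_eq]; exact hclose i)
      rw [Real.dist_eq, Real.log_one, sub_zero] at this
      exact this.le) (by
      rw [← Real.log_prod (fun i _ => (ha i).ne'), hprod, Real.log_one])
  simp only [Real.exp_sub, Real.exp_neg, Real.exp_log (ha _), div_div] at h
  simpa only [one_div] using h

/-! ### The Lie algebra of a subgroup is closed under the bracket. -/

namespace HomogeneousSpace

section BracketClosed

open VectorField

theorem mem_of_tendsto_of_mem {V : Type*} [NormedAddCommGroup V] [NormedSpace ℝ V]
    [FiniteDimensional ℝ V] (W : Submodule ℝ V) {f : ℝ → V} {v : V}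
    (hf : Filter.Tendsto f (𝓝[≠] 0) (𝓝 v)) (hW : ∀ t, f t ∈ W) : v ∈ W :=
  W.closed_of_finiteDimensional.mem_of_tendsto hf (Filter.Eventually.of_forall hW)

/-- If `μ` is a local group law with unit `e`, the vectors `A t` defined along a curve `x` by
`d(R_x) (A t) = d(L_x) Y` satisfy `(A t - Y) / t → [x'(0), Y]`. -/
theorem tendsto_slope_of_fderiv_eq {V : Type*} [NormedAddCommGroup V] [NormedSpace ℝ V]
    [FiniteDimensional ℝ V] {μ : V × V → V} {e : V} (hμ : ContDiffAt ℝ 2 μ (e, e))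
    (hfst : ∀ v, fderiv ℝ μ (e, e) (v, 0) = v) (hsnd : ∀ v, fderiv ℝ μ (e, e) (0, v) = v)
    (x : ℝ → V) (hx0 : x 0 = e) (X Y : V) (hxd : HasDerivAt x X 0) (A : ℝ → V)
    (hA : ∀ᶠ t in 𝓝 0, fderiv ℝ μ (e, x t) (A t, 0) = fderiv ℝ μ (x t, e) (0, Y)) :
    Filter.Tendsto (fun t => t⁻¹ • (A t - Y)) (𝓝[≠] 0)
      (𝓝 (fderiv ℝ (fderiv ℝ μ) (e, e) (X, 0) (0, Y) -
        fderiv ℝ (fderiv ℝ μ) (e, e) (Y, 0) (0, X))) := by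
  set F := fderiv ℝ μ with hF
  have hdiff : DifferentiableAt ℝ F (e, e) :=
    (hμ.fderiv_right (m := 1) (by norm_num)).differentiableAt (by simp)
  have hsymm : ∀ p q, fderiv ℝ F (e, e) p q = fderiv ℝ F (e, e) q p :=
    hμ.isSymmSndFDerivAt (by simp)
  -- No regularity of A is assumed. It is recovered from R t = P t (A t - Y), where R is
  -- differentiable at 0 with R 0 = 0, and P t tends to 1, hence is eventually invertible.
  set P : ℝ → V →L[ℝ] V := fun t => (F (e, x t)).comp (ContinuousLinearMap.inl ℝ V V) with hP
  set R : ℝ → V := fun t => F (x t, e) (0, Y) - F (e, x t) (Y, 0) with hR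
  have hd1 : HasDerivAt (fun t => F (x t, e)) (fderiv ℝ F (e, e) (X, 0)) 0 :=
    HasFDerivAt.comp_hasDerivAt (f := fun t => (x t, e)) 0
      (by rw [hx0]; exact hdiff.hasFDerivAt) (hxd.prodMk (hasDerivAt_const 0 e))
  have hd2 : HasDerivAt (fun t => F (e, x t)) (fderiv ℝ F (e, e) (0, X)) 0 :=
    HasFDerivAt.comp_hasDerivAt (f := fun t => (e, x t)) 0
      (by rw [hx0]; exact hdiff.hasFDerivAt) ((hasDerivAt_const 0 e).prodMk hxd)
  have hR0 : R 0 = 0 := by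
    simp only [hR, hx0, hfst, hsnd, sub_self]
  have hRd : HasDerivAt R (fderiv ℝ F (e, e) (X, 0) (0, Y) - fderiv ℝ F (e, e) (Y, 0) (0, X)) 0 := by
    -- Symmetry of the second derivative puts the direction of differentiation (0, X) first, as
    -- differentiating R requires.
    rw [hsymm (Y, 0)]
    exact ((ContinuousLinearMap.apply ℝ V ((0 : V), Y)).hasFDerivAt.comp_hasDerivAt 0 hd1).sub
      ((ContinuousLinearMap.apply ℝ V (Y, (0 : V))).hasFDerivAt.comp_hasDerivAt 0 hd2)
  have hP0 : P 0 = 1 := by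
    refine ContinuousLinearMap.ext fun v => ?_
    simp only [hP, hx0]
    exact hfst v
  have hPc : Filter.Tendsto P (𝓝 0) (𝓝 1) := by
    have h1 : ContinuousAt P 0 := hd2.continuousAt.clm_comp continuousAt_const
    have := h1.tendsto
    rwa [hP0] at this
  have hPinv : Filter.Tendsto (fun t => Ring.inverse (P t)) (𝓝 0) (𝓝 1) := by
    have h1 := (NormedRing.inverse_continuousAt (1 : (V →L[ℝ] V)ˣ)).tendsto
    rw [Units.val_one, Ring.inverse_one] at h1
    exact h1.comp hPc
  have hPunit : ∀ᶠ t in 𝓝 (0 : ℝ), IsUnit (P t) := hPc (Units.nhds (1 : (V →L[ℝ] V)ˣ))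
  have h1 := hasDerivAt_iff_tendsto_slope_zero.1 hRd
  simp only [zero_add, hR0, sub_zero] at h1
  have h2 := (isBoundedBilinearMap_apply (𝕜 := ℝ) (E := V) (F := V)).continuous.continuousAt
    |>.tendsto.comp ((hPinv.mono_left (nhdsWithin_le_nhds (s := {0}ᶜ))).prodMk_nhds h1)
  refine h2.congr' ?_
  filter_upwards [nhdsWithin_le_nhds hPunit, nhdsWithin_le_nhds hA] with t ht1 ht2
  have h3 : R t = P t (A t - Y) := by
    rw [map_sub]
    simp only [hR, hP, ← ht2]
    rfl
  rw [Function.comp_apply, h3, map_smul, ← mul_apply_eq_comp, Ring.inverse_mul_cancel _ ht1,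
    one_apply_eq_self]

/-- The fields x ↦ dμ(x, e)(0, v) are the left-invariant fields of the local group law; their
derivatives at e are mixed second derivatives of μ. -/
theorem lieBracket_of_fderiv {V : Type*} [NormedAddCommGroup V] [NormedSpace ℝ V]
    {μ : V × V → V} {e : V} (hμ : ContDiffAt ℝ 2 μ (e, e))
    (hsnd : ∀ v, fderiv ℝ μ (e, e) (0, v) = v) (v w : V) :
    lieBracket ℝ (fun x => fderiv ℝ μ (x, e) (0, v)) (fun x => fderiv ℝ μ (x, e) (0, w)) e =
      fderiv ℝ (fderiv ℝ μ) (e, e) (v, 0) (0, w) -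
        fderiv ℝ (fderiv ℝ μ) (e, e) (w, 0) (0, v) := by
  have hdiff : DifferentiableAt ℝ (fderiv ℝ μ) (e, e) :=
    (hμ.fderiv_right (m := 1) (by norm_num)).differentiableAt (by simp)
  have hder : ∀ u : V, HasFDerivAt (fun x => fderiv ℝ μ (x, e) (0, u))
      (((ContinuousLinearMap.apply ℝ V ((0 : V), u)).comp (fderiv ℝ (fderiv ℝ μ) (e, e))).comp
        (ContinuousLinearMap.inl ℝ V V)) e :=
    fun u => HasFDerivAt.comp (f := fun x => (x, e)) e
      ((ContinuousLinearMap.apply ℝ V ((0 : V), u)).hasFDerivAt.comp (e, e) hdiff.hasFDerivAt)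
      (hasFDerivAt_prodMk_left (𝕜 := ℝ) e e)
  rw [lieBracket, (hder _).fderiv, (hder _).fderiv, hsnd, hsnd]
  rfl

variable {E : Type*} [NormedAddCommGroup E] [NormedSpace ℝ E]
  {G : Type*} [TopologicalSpace G] [ChartedSpace E G] [Group G]

variable (E G) in
/-- The multiplication of `G` in the preferred chart at the identity. -/
noncomputable def chartMul (p : E × E) : E :=
  extChartAt 𝓘(ℝ, E) (1 : G) ((extChartAt 𝓘(ℝ, E) (1 : G)).symm p.1 *
    (extChartAt 𝓘(ℝ, E) (1 : G)).symm p.2)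

variable [LieGroup 𝓘(ℝ, E) ∞ G]

theorem contDiffAt_chartMul : ContDiffAt ℝ ∞ (chartMul E G)
    (extChartAt 𝓘(ℝ, E) (1 : G) 1, extChartAt 𝓘(ℝ, E) (1 : G) 1) := by
  rw [← contMDiffAt_iff_contDiffAt]
  have hs : ContMDiffAt 𝓘(ℝ, E) 𝓘(ℝ, E) ∞ (extChartAt 𝓘(ℝ, E) (1 : G)).symm
      (extChartAt 𝓘(ℝ, E) (1 : G) 1) :=
    (contMDiffOn_extChartAt_symm (1 : G)).contMDiffAt (extChartAt_target_mem_nhds (1 : G))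
  have h1 : ContMDiffAt 𝓘(ℝ, E × E) 𝓘(ℝ, E) ∞
      (fun p : E × E => (extChartAt 𝓘(ℝ, E) (1 : G)).symm p.1 *
        (extChartAt 𝓘(ℝ, E) (1 : G)).symm p.2)
      (extChartAt 𝓘(ℝ, E) (1 : G) 1, extChartAt 𝓘(ℝ, E) (1 : G) 1) :=
    (hs.comp (_, _) contDiffAt_fst.contMDiffAt).mul (hs.comp (_, _) contDiffAt_snd.contMDiffAt)
  have h2 : ContMDiffAt 𝓘(ℝ, E) 𝓘(ℝ, E) ∞ (extChartAt 𝓘(ℝ, E) (1 : G))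
      ((extChartAt 𝓘(ℝ, E) (1 : G)).symm (extChartAt 𝓘(ℝ, E) (1 : G) 1) *
        (extChartAt 𝓘(ℝ, E) (1 : G)).symm (extChartAt 𝓘(ℝ, E) (1 : G) 1)) := by
    rw [extChartAt_to_inv, mul_one]
    exact contMDiffAt_extChartAt
  exact h2.comp (_, _) h1

theorem hasMFDerivAt_extChartAt_one :
    HasMFDerivAt 𝓘(ℝ, E) 𝓘(ℝ, E) (extChartAt 𝓘(ℝ, E) (1 : G)) 1 (ContinuousLinearMap.id ℝ E) := by
  have : IsManifold 𝓘(ℝ, E) 1 G := .of_le (n := ∞) (by simp)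
  have h := (mdifferentiableAt_extChartAt (I := 𝓘(ℝ, E)) (mem_chart_source E (1 : G))).hasMFDerivAt
  rw [mfderiv_extChartAt_self] at h
  exact h

omit [LieGroup 𝓘(ℝ, E) ∞ G] in
theorem eventually_mem_source : ∀ᶠ y in 𝓝 (1 : G), y ∈ (extChartAt 𝓘(ℝ, E) (1 : G)).source :=
  extChartAt_source_mem_nhds (1 : G)

theorem hasMFDerivAt_chart_mul_left {g : G} (hg : g ∈ (extChartAt 𝓘(ℝ, E) (1 : G)).source)
    (hd : DifferentiableAt ℝ (chartMul E G)
      (extChartAt 𝓘(ℝ, E) (1 : G) g, extChartAt 𝓘(ℝ, E) (1 : G) 1)) :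
    HasMFDerivAt 𝓘(ℝ, E) 𝓘(ℝ, E) (fun y : G => extChartAt 𝓘(ℝ, E) (1 : G) (g * y)) 1
      ((fderiv ℝ (chartMul E G) (extChartAt 𝓘(ℝ, E) (1 : G) g, extChartAt 𝓘(ℝ, E) (1 : G) 1)).comp
        (ContinuousLinearMap.inr ℝ E E)) := by
  have h1 := hd.hasFDerivAt.comp _ (hasFDerivAt_prodMk_right (𝕜 := ℝ)
    (extChartAt 𝓘(ℝ, E) (1 : G) g) (extChartAt 𝓘(ℝ, E) (1 : G) 1))
  have h2 := HasMFDerivAt.comp (1 : G) h1.hasMFDerivAt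
    (hasMFDerivAt_extChartAt_one (E := E) (G := G))
  refine (h2.congr_of_eventuallyEq ?_).congr_mfderiv ?_
  · filter_upwards [eventually_mem_source (E := E)] with y hy
    simp only [Function.comp_apply, chartMul, (extChartAt 𝓘(ℝ, E) (1 : G)).left_inv hg,
      (extChartAt 𝓘(ℝ, E) (1 : G)).left_inv hy]
  · rfl

theorem hasMFDerivAt_conj (g : G) :
    HasMFDerivAt 𝓘(ℝ, E) 𝓘(ℝ, E) (fun y : G => g * y * g⁻¹) 1
      (mfderiv 𝓘(ℝ, E) 𝓘(ℝ, E) (fun y : G => g * y * g⁻¹) 1) := by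
  refine MDifferentiableAt.hasMFDerivAt ?_
  have : ContMDiff 𝓘(ℝ, E) 𝓘(ℝ, E) ∞ (fun y : G => g * y * g⁻¹) :=
    (contMDiff_const.mul contMDiff_id).mul contMDiff_const
  exact this.mdifferentiableAt (by simp)

/-- Writing g y = (g y g⁻¹) g factors left translation as conjugation followed by right translation.
-/
theorem hasMFDerivAt_chart_conj_mul {g : G} (hg : g ∈ (extChartAt 𝓘(ℝ, E) (1 : G)).source)
    (hd : DifferentiableAt ℝ (chartMul E G)
      (extChartAt 𝓘(ℝ, E) (1 : G) 1, extChartAt 𝓘(ℝ, E) (1 : G) g)) :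
    HasMFDerivAt 𝓘(ℝ, E) 𝓘(ℝ, E) (fun y : G => extChartAt 𝓘(ℝ, E) (1 : G) (g * y)) 1
      (((fderiv ℝ (chartMul E G)
        (extChartAt 𝓘(ℝ, E) (1 : G) 1, extChartAt 𝓘(ℝ, E) (1 : G) g)).comp
        (ContinuousLinearMap.inl ℝ E E)).comp
        (mfderiv 𝓘(ℝ, E) 𝓘(ℝ, E) (fun y : G => g * y * g⁻¹) 1 : E →L[ℝ] E)) := by
  have e1 : g * 1 * g⁻¹ = 1 := by simp
  have h0 : HasMFDerivAt 𝓘(ℝ, E) 𝓘(ℝ, E) (extChartAt 𝓘(ℝ, E) (1 : G)) (g * 1 * g⁻¹)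
      (ContinuousLinearMap.id ℝ E) := by
    rw [e1]; exact hasMFDerivAt_extChartAt_one
  have h1 := HasFDerivAt.comp (f := fun w => (w, extChartAt 𝓘(ℝ, E) (1 : G) g)) _ hd.hasFDerivAt
    (hasFDerivAt_prodMk_left (𝕜 := ℝ) (extChartAt 𝓘(ℝ, E) (1 : G) 1)
      (extChartAt 𝓘(ℝ, E) (1 : G) g))
  have e2 : extChartAt 𝓘(ℝ, E) (1 : G) 1 =
      (extChartAt 𝓘(ℝ, E) (1 : G) ∘ fun y : G => g * y * g⁻¹) 1 := by simp
  have h1' : HasFDerivAt (chartMul E G ∘ fun w => (w, extChartAt 𝓘(ℝ, E) (1 : G) g))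
      ((fderiv ℝ (chartMul E G)
        (extChartAt 𝓘(ℝ, E) (1 : G) 1, extChartAt 𝓘(ℝ, E) (1 : G) g)).comp
        (ContinuousLinearMap.inl ℝ E E))
      ((extChartAt 𝓘(ℝ, E) (1 : G) ∘ fun y : G => g * y * g⁻¹) 1) := by
    rw [← e2]; exact h1
  have h2 := HasMFDerivAt.comp (1 : G) h1'.hasMFDerivAt
    (HasMFDerivAt.comp (1 : G) h0 (hasMFDerivAt_conj g))
  refine (h2.congr_of_eventuallyEq ?_).congr_mfderiv ?_
  · have hcont : Filter.Tendsto (fun y : G => g * y * g⁻¹) (𝓝 1) (𝓝 1) := by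
      have := (hasMFDerivAt_conj (E := E) g).continuousAt.tendsto
      rwa [e1] at this
    filter_upwards [hcont.eventually (eventually_mem_source (E := E))] with y hy
    have h3 := (extChartAt 𝓘(ℝ, E) (1 : G)).left_inv hy
    simp only [Function.comp_apply, chartMul, h3, (extChartAt 𝓘(ℝ, E) (1 : G)).left_inv hg,
      inv_mul_cancel_right]
  · rfl

/-- dR_g (Ad g Y) = dL_g Y: two computations of the derivative of y ↦ g y at 1 are compared. This
supplies the hypothesis on A in `tendsto_slope_of_fderiv_eq`. -/
theorem fderiv_chartMul_Ad {g : G} (hg : g ∈ (extChartAt 𝓘(ℝ, E) (1 : G)).source)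
    (hd : DifferentiableAt ℝ (chartMul E G)
      (extChartAt 𝓘(ℝ, E) (1 : G) g, extChartAt 𝓘(ℝ, E) (1 : G) 1))
    (hd' : DifferentiableAt ℝ (chartMul E G)
      (extChartAt 𝓘(ℝ, E) (1 : G) 1, extChartAt 𝓘(ℝ, E) (1 : G) g))
    (Y : GroupLieAlgebra 𝓘(ℝ, E) G) :
    fderiv ℝ (chartMul E G) (extChartAt 𝓘(ℝ, E) (1 : G) 1, extChartAt 𝓘(ℝ, E) (1 : G) g)
      ((Ad E g Y : E), (0 : E)) =
    fderiv ℝ (chartMul E G) (extChartAt 𝓘(ℝ, E) (1 : G) g, extChartAt 𝓘(ℝ, E) (1 : G) 1)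
      ((0 : E), (Y : E)) := by
  have h := hasMFDerivAt_unique (hasMFDerivAt_chart_conj_mul hg hd')
    (hasMFDerivAt_chart_mul_left hg hd)
  exact congrArg (fun f : E →L[ℝ] E => f (Y : E)) h

theorem fderiv_chartMul_invariantField {g : G} (hg : g ∈ (extChartAt 𝓘(ℝ, E) (1 : G)).source)
    (hd : DifferentiableAt ℝ (chartMul E G)
      (extChartAt 𝓘(ℝ, E) (1 : G) g, extChartAt 𝓘(ℝ, E) (1 : G) 1))
    (Y : GroupLieAlgebra 𝓘(ℝ, E) G) :
    mfderiv 𝓘(ℝ, E) 𝓘(ℝ, E) (extChartAt 𝓘(ℝ, E) (1 : G)) g (mulInvariantVectorField Y g) =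
    fderiv ℝ (chartMul E G) (extChartAt 𝓘(ℝ, E) (1 : G) g, extChartAt 𝓘(ℝ, E) (1 : G) 1)
      ((0 : E), (Y : E)) := by
  have : IsManifold 𝓘(ℝ, E) 1 G := .of_le (n := ∞) (by simp)
  have h1 : HasMFDerivAt 𝓘(ℝ, E) 𝓘(ℝ, E) (extChartAt 𝓘(ℝ, E) (1 : G)) (g * 1)
      (mfderiv 𝓘(ℝ, E) 𝓘(ℝ, E) (extChartAt 𝓘(ℝ, E) (1 : G)) g : E →L[ℝ] E) := by
    rw [mul_one]
    exact (mdifferentiableAt_extChartAt (by rwa [← extChartAt_source 𝓘(ℝ, E)])).hasMFDerivAt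
  have h2 : HasMFDerivAt 𝓘(ℝ, E) 𝓘(ℝ, E) (fun y : G => g * y) 1
      (mfderiv 𝓘(ℝ, E) 𝓘(ℝ, E) (fun y : G => g * y) 1) :=
    ((contMDiff_mul_left (I := 𝓘(ℝ, E)) (n := ∞) (a := g)).mdifferentiableAt
      (by simp)).hasMFDerivAt
  have h := hasMFDerivAt_unique (HasMFDerivAt.comp (1 : G) h1 h2)
    (hasMFDerivAt_chart_mul_left hg hd)
  exact congrArg (fun f : E →L[ℝ] E => f (Y : E)) h

/-- Identifies the fields of `lieBracket_of_fderiv` with the invariant fields that define the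
bracket of `GroupLieAlgebra`. -/
theorem pullback_invariantField {x : E} (hx : x ∈ (extChartAt 𝓘(ℝ, E) (1 : G)).target)
    (hd : DifferentiableAt ℝ (chartMul E G) (x, extChartAt 𝓘(ℝ, E) (1 : G) 1))
    (Y : GroupLieAlgebra 𝓘(ℝ, E) G) :
    mpullbackWithin 𝓘(ℝ, E) 𝓘(ℝ, E) (extChartAt 𝓘(ℝ, E) (1 : G)).symm (mulInvariantVectorField Y)
      (Set.range 𝓘(ℝ, E)) x =
    fderiv ℝ (chartMul E G) (x, extChartAt 𝓘(ℝ, E) (1 : G) 1) ((0 : E), (Y : E)) := by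
  have : IsManifold 𝓘(ℝ, E) 1 G := .of_le (n := ∞) (by simp)
  have h := fderiv_chartMul_invariantField (E := E) (G := G)
    ((extChartAt 𝓘(ℝ, E) (1 : G)).map_target hx)
    (by rwa [(extChartAt 𝓘(ℝ, E) (1 : G)).right_inv hx]) Y
  rw [(extChartAt 𝓘(ℝ, E) (1 : G)).right_inv hx] at h
  rw [← h, mpullbackWithin_apply]
  congr 1
  exact ContinuousLinearMap.inverse_eq (mfderivWithin_extChartAt_symm_comp_mfderiv_extChartAt hx)
    (mfderiv_extChartAt_comp_mfderivWithin_extChartAt_symm hx)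

theorem eventually_differentiableAt_chartMul :
    ∀ᶠ p in 𝓝 (extChartAt 𝓘(ℝ, E) (1 : G) 1, extChartAt 𝓘(ℝ, E) (1 : G) 1),
      DifferentiableAt ℝ (chartMul E G) p := by
  have h : ContDiffAt ℝ 1 (chartMul E G)
    (extChartAt 𝓘(ℝ, E) (1 : G) 1, extChartAt 𝓘(ℝ, E) (1 : G) 1) :=
      contDiffAt_chartMul.of_le (by simp)
  filter_upwards [h.eventually (by simp)] with p hp
  exact hp.differentiableAt (by simp)

theorem contDiffAt_two_chartMul : ContDiffAt ℝ 2 (chartMul E G)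
    (extChartAt 𝓘(ℝ, E) (1 : G) 1, extChartAt 𝓘(ℝ, E) (1 : G) 1) :=
  contDiffAt_chartMul.of_le ENat.LEInfty.out

theorem fderiv_chartMul_one_snd (v : E) :
    fderiv ℝ (chartMul E G) (extChartAt 𝓘(ℝ, E) (1 : G) 1, extChartAt 𝓘(ℝ, E) (1 : G) 1)
      ((0 : E), v) = v := by
  have h := hasMFDerivAt_unique (hasMFDerivAt_chart_mul_left (E := E) (mem_extChartAt_source (1 : G))
    (eventually_differentiableAt_chartMul.self_of_nhds))
    ((hasMFDerivAt_extChartAt_one (E := E) (G := G)).congr_of_eventuallyEq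
      (Filter.Eventually.of_forall fun y => by simp))
  exact congrArg (fun f : E →L[ℝ] E => f v) h

theorem fderiv_chartMul_one_fst (v : E) :
    fderiv ℝ (chartMul E G) (extChartAt 𝓘(ℝ, E) (1 : G) 1, extChartAt 𝓘(ℝ, E) (1 : G) 1)
      (v, (0 : E)) = v := by
  have h := fderiv_chartMul_Ad (E := E) (mem_extChartAt_source (1 : G))
    (eventually_differentiableAt_chartMul.self_of_nhds)
    (eventually_differentiableAt_chartMul.self_of_nhds) v
  have h1 : Ad E (1 : G) v = v := by
    have e : (fun y : G => 1 * y * 1⁻¹) = id := by ext; simp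
    have := hasMFDerivAt_conj (E := E) (1 : G)
    have h2 := hasMFDerivAt_unique this (by rw [e]; exact hasMFDerivAt_id (I := 𝓘(ℝ, E)) (1 : G))
    exact congrArg (fun f : E →L[ℝ] E => f v) h2
  rw [h1] at h
  exact h.trans (fderiv_chartMul_one_snd v)

/-- The Lie bracket in terms of the second derivative of the multiplication. -/
theorem bracket_eq_fderiv_fderiv (X Y : GroupLieAlgebra 𝓘(ℝ, E) G) :
    (⁅X, Y⁆ : GroupLieAlgebra 𝓘(ℝ, E) G) =
      fderiv ℝ (fderiv ℝ (chartMul E G))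
        (extChartAt 𝓘(ℝ, E) (1 : G) 1, extChartAt 𝓘(ℝ, E) (1 : G) 1)
        ((X : E), (0 : E)) ((0 : E), (Y : E)) -
      fderiv ℝ (fderiv ℝ (chartMul E G))
        (extChartAt 𝓘(ℝ, E) (1 : G) 1, extChartAt 𝓘(ℝ, E) (1 : G) 1)
        ((Y : E), (0 : E)) ((0 : E), (X : E)) := by
  have : IsManifold 𝓘(ℝ, E) 1 G := .of_le (n := ∞) (by simp)
  set e := extChartAt 𝓘(ℝ, E) (1 : G) 1 with he
  have hfield : ∀ Z : GroupLieAlgebra 𝓘(ℝ, E) G,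
      mpullbackWithin 𝓘(ℝ, E) 𝓘(ℝ, E) (extChartAt 𝓘(ℝ, E) (1 : G)).symm
        (mulInvariantVectorField Z) (Set.range 𝓘(ℝ, E)) =ᶠ[𝓝 e]
      fun x => fderiv ℝ (chartMul E G) (x, e) ((0 : E), (Z : E)) := fun Z => by
    have hcont : Filter.Tendsto (fun x : E => (x, e)) (𝓝 e) (𝓝 (e, e)) :=
      (Continuous.prodMk_left e).tendsto e
    filter_upwards [extChartAt_target_mem_nhds (I := 𝓘(ℝ, E)) (1 : G),
      hcont.eventually eventually_differentiableAt_chartMul] with x hx hd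
    exact pullback_invariantField hx hd Z
  rw [GroupLieAlgebra.bracket_def, mlieBracket, mlieBracketWithin_apply, mfderiv_extChartAt_self]
  change (ContinuousLinearMap.id ℝ E).inverse _ = _
  rw [ContinuousLinearMap.inverse_id]
  have hset : (extChartAt 𝓘(ℝ, E) (1 : G)).symm ⁻¹' Set.univ ∩ Set.range 𝓘(ℝ, E) = Set.univ := by
    simp
  rw [hset]
  refine Eq.trans (congrFun lieBracketWithin_univ e) (Eq.trans
    ((hfield X).lieBracket_vectorField_eq (hfield Y)) ?_)
  exact lieBracket_of_fderiv (V := E) contDiffAt_two_chartMul fderiv_chartMul_one_snd X Y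

theorem Ad_mem_lieAlgebra {H : Subgroup G} {h : G} (hh : h ∈ H) {Y : GroupLieAlgebra 𝓘(ℝ, E) G}
    (hY : Y ∈ lieAlgebra E H) : Ad E h Y ∈ lieAlgebra E H := by
  obtain ⟨γ, h0, hγ, hv⟩ := hY
  refine ⟨fun t => h * γ t * h⁻¹, by simp [h0],
    fun t => H.mul_mem (H.mul_mem hh (hγ t)) (H.inv_mem hh), ?_⟩
  have h1 : HasMFDerivAt 𝓘(ℝ, E) 𝓘(ℝ, E) (fun y : G => h * y * h⁻¹) (γ 0)
      (mfderiv 𝓘(ℝ, E) 𝓘(ℝ, E) (fun y : G => h * y * h⁻¹) 1 : E →L[ℝ] E) := by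
    rw [h0]; exact hasMFDerivAt_conj h
  refine (HasMFDerivAt.comp (0 : ℝ) h1 hv).congr_mfderiv ?_
  refine ContinuousLinearMap.ext fun t => ?_
  exact ContinuousLinearMap.map_smul
    (mfderiv 𝓘(ℝ, E) 𝓘(ℝ, E) (fun y : G => h * y * h⁻¹) 1 : E →L[ℝ] E) t (Y : E)

/-- The Lie algebra of a subgroup is closed under the Lie bracket. -/
theorem lie_mem_lieAlgebra [FiniteDimensional ℝ E] {H : Subgroup G}
    {X Y : GroupLieAlgebra 𝓘(ℝ, E) G} (hX : X ∈ lieAlgebra E H) (hY : Y ∈ lieAlgebra E H) :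
    ⁅X, Y⁆ ∈ lieAlgebra E H := by
  obtain ⟨γ, h0, hγ, hv⟩ := hX
  set e := extChartAt 𝓘(ℝ, E) (1 : G) 1 with he
  set x : ℝ → E := fun t => extChartAt 𝓘(ℝ, E) (1 : G) (γ t) with hx
  have hx0 : x 0 = e := by rw [hx, he]; simp [h0]
  have hxd : HasDerivAt x (X : E) 0 := by
    have h1 : HasMFDerivAt 𝓘(ℝ, E) 𝓘(ℝ, E) (extChartAt 𝓘(ℝ, E) (1 : G)) (γ 0)
      (ContinuousLinearMap.id ℝ E) := by rw [h0]; exact hasMFDerivAt_extChartAt_one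
    have h2 : HasFDerivAt x (ContinuousLinearMap.toSpanSingleton ℝ (X : E)) 0 :=
      (HasMFDerivAt.comp (0 : ℝ) h1 hv).hasFDerivAt.congr_fderiv rfl
    exact h2.hasDerivAt.congr_deriv (one_smul ℝ (X : E))
  have hcγ : Filter.Tendsto γ (𝓝 0) (𝓝 1) := by
    have := hv.continuousAt.tendsto; rwa [h0] at this
  -- (Ad(γ t)Y - Y)/t tends to the expression that `bracket_eq_fderiv_fderiv` identifies with [X,
  -- Y]. Each quotient lies in 𝔥 because γ t ∈ H, and 𝔥 is a closed subspace.
  have hlim := tendsto_slope_of_fderiv_eq (V := E) (contDiffAt_two_chartMul (E := E) (G := G))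
    fderiv_chartMul_one_fst fderiv_chartMul_one_snd x hx0 X Y hxd (fun t => Ad E (γ t) Y) (by
      have hc : ContinuousAt x 0 := hxd.continuousAt
      have hc1 : Filter.Tendsto (fun t => (x t, e)) (𝓝 0) (𝓝 (e, e)) := by
        have := (hc.prodMk (continuousAt_const (y := e))).tendsto
        rwa [hx0] at this
      have hc2 : Filter.Tendsto (fun t => (e, x t)) (𝓝 0) (𝓝 (e, e)) := by
        have := ((continuousAt_const (y := e)).prodMk hc).tendsto
        rwa [hx0] at this
      filter_upwards [hcγ.eventually (eventually_mem_source (E := E)),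
        hc1.eventually eventually_differentiableAt_chartMul,
        hc2.eventually eventually_differentiableAt_chartMul] with t h1 h2 h3
      exact fderiv_chartMul_Ad h1 h2 h3 Y)
  rw [bracket_eq_fderiv_fderiv]
  exact mem_of_tendsto_of_mem (V := E) (lieAlgebra E H) hlim fun t =>
    (lieAlgebra E H).smul_mem t⁻¹ ((lieAlgebra E H).sub_mem (Ad_mem_lieAlgebra (hγ t) hY) hY)

end BracketClosed

end HomogeneousSpace

/-! ### Eigenvalues and volume of a nearby inner product. -/

section Comparison

variable {V : Type*} [AddCommGroup V] [Module ℝ V] {ι : Type*} [Fintype ι] [DecidableEq ι]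
  (m m' : LinearMap.BilinForm ℝ V)

/-- An `m`-unit vector has coordinates of modulus at most 1 in y. With y fixed, this controls the
eigenvalues of `m'`, whose eigenbasis varies with `m'`. -/
theorem abs_sub_le_of_basis_close (y : Module.Basis ι ℝ V)
    (hy : ∀ i j, m (y i) (y j) = if i = j then 1 else 0) {ε : ℝ}
    (hclose : ∀ i j, |m' (y i) (y j) - m (y i) (y j)| ≤ ε) (u : V) (hu : m u u = 1) :
    |m' u u - 1| ≤ Fintype.card ι ^ 2 * ε := by
  have hrepr : ∀ i, |y.repr u i| ≤ 1 := fun i => by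
    have h1 := parseval_of_orthonormal m y hy u u
    simp only [← repr_eq_of_orthonormal m y hy] at h1
    have h2 : y.repr u i * y.repr u i ≤ ∑ i, y.repr u i * y.repr u i :=
      Finset.single_le_sum (f := fun i => y.repr u i * y.repr u i)
        (fun i _ => mul_self_nonneg _) (Finset.mem_univ i)
    rw [← h1, hu] at h2
    exact abs_le_one_iff_mul_self_le_one.2 h2
  have hexp : m' u u - 1 =
      ∑ i, ∑ j, y.repr u i * (y.repr u j * (m' (y j) (y i) - m (y j) (y i))) := by
    have h := congrArg (fun w => (m' - m) w w) (y.sum_repr u)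
    simp only [map_sum, map_smul, LinearMap.sum_apply, LinearMap.smul_apply, smul_eq_mul,
      LinearMap.sub_apply, hu, Finset.mul_sum] at h
    rw [← h]
  rw [hexp]
  refine (Finset.abs_sum_le_sum_abs _ _).trans ((Finset.sum_le_sum fun i _ =>
    (Finset.abs_sum_le_sum_abs _ _).trans (Finset.sum_le_sum (g := fun _ => ε) fun j _ => ?_)).trans
      (le_of_eq ?_))
  · rw [abs_mul, abs_mul]
    calc |y.repr u i| * (|y.repr u j| * |m' (y j) (y i) - m (y j) (y i)|)
        ≤ 1 * (1 * ε) := by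
          gcongr
          · exact hrepr i
          · exact hrepr j
          · exact hclose j i
      _ = ε := by ring
  · simp
    ring

/-- A change of basis multiplies both Gram determinants by the same square, so their ratio, ∏ a_i in
the basis x, may be computed in b. -/
theorem prod_eq_one_of_sqrt_det_eq (b x : Module.Basis ι ℝ V)
    (hx : ∀ i j, m (x i) (x j) = if i = j then 1 else 0) (a : ι → ℝ) (ha : ∀ i, 0 < a i)
    (hdiag : ∀ i j, m' (x i) (x j) = if i = j then a i else 0)
    (hdet : √(LinearMap.BilinForm.toMatrix b m').det = √(LinearMap.BilinForm.toMatrix b m).det) :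
    ∏ i, a i = 1 := by
  have h1 : LinearMap.BilinForm.toMatrix x m = 1 := by
    ext i j
    rw [LinearMap.BilinForm.toMatrix_apply, hx, Matrix.one_apply]
  have h2 : LinearMap.BilinForm.toMatrix x m' = Matrix.diagonal a := by
    ext i j
    rw [LinearMap.BilinForm.toMatrix_apply, hdiag, Matrix.diagonal_apply]
  have k : ∀ B : LinearMap.BilinForm ℝ V, (b.toMatrix x).det ^ 2 *
      (LinearMap.BilinForm.toMatrix b B).det = (LinearMap.BilinForm.toMatrix x B).det := fun B => by
    rw [← LinearMap.BilinForm.toMatrix_mul_basis_toMatrix b x B, Matrix.det_mul, Matrix.det_mul,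
      Matrix.det_transpose]
    ring
  have k1 := k m
  have k2 := k m'
  rw [h1, Matrix.det_one] at k1
  rw [h2, Matrix.det_diagonal] at k2
  have p1 : 0 < (LinearMap.BilinForm.toMatrix b m).det :=
    pos_of_mul_pos_right (k1 ▸ one_pos) (sq_nonneg _)
  have p2 : 0 < (LinearMap.BilinForm.toMatrix b m').det :=
    pos_of_mul_pos_right (k2 ▸ Finset.prod_pos fun i _ => ha i) (sq_nonneg _)
  rw [Real.sqrt_inj p2.le p1.le] at hdet
  rw [← k2, hdet, k1]

end Comparison

/-! ### The topology on invariant metrics and the main theorem. -/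

namespace HomogeneousSpace

variable {E : Type*} [NormedAddCommGroup E] [NormedSpace ℝ E] [FiniteDimensional ℝ E]
  {G : Type*} [TopologicalSpace G] [ChartedSpace E G] [Group G] [LieGroup 𝓘(ℝ, E) ∞ G]

namespace InvariantMetric

theorem continuous_form_apply {H : Subgroup G} (X Y : TangentModule E H) :
    Continuous fun m : InvariantMetric E H => m.form X Y :=
  (continuous_apply Y).comp ((continuous_apply X).comp
    (continuous_induced_dom (f := fun (m : InvariantMetric E H) X Y => m.form X Y)))

theorem eventually_basis_close {H : Subgroup G} (m : InvariantMetric E H) {ι : Type*} [Finite ι]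
    (y : ι → TangentModule E H) {ε : ℝ} (hε : 0 < ε) :
    ∀ᶠ m' in 𝓝 m, ∀ i j, |m'.form (y i) (y j) - m.form (y i) (y j)| ≤ ε := by
  rw [Filter.eventually_all]
  intro i
  rw [Filter.eventually_all]
  intro j
  filter_upwards [Metric.tendsto_nhds.1 (continuous_form_apply (y i) (y j)).continuousAt ε hε]
    with m' hm'
  exact le_of_lt hm'

end InvariantMetric

end HomogeneousSpace

open HomogeneousSpace in
theorem theorem2 {E : Type*} [NormedAddCommGroup E] [NormedSpace ℝ E] [FiniteDimensional ℝ E]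
    {G : Type*} [TopologicalSpace G] [ChartedSpace E G] [Group G] [LieGroup 𝓘(ℝ, E) ∞ G]
    [T2Space G] [CompactSpace G] [ConnectedSpace G]
    [LieAlgebra.IsSemisimple ℝ (GroupLieAlgebra 𝓘(ℝ, E) G)]
    (H : Subgroup G) (hH : IsClosed (H : Set G)) (heff : IsAlmostEffective E H)
    (m : InvariantMetric E H) (hstd : m.IsStandard) (hein : m.IsEinstein)
    (c : ℝ) (hcas : IsCasimirConstant E H c) (hc : 3 / 10 < c)
    (v : ℝ) (hv : m ∈ InvariantMetric.ofVolume H v) :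
    IsLocalMinOn InvariantMetric.scalarCurvature (InvariantMetric.ofVolume H v) m := by
  obtain ⟨r, hein⟩ := hein
  obtain ⟨z, hz, X, hX, hX0, hcasX⟩ := hcas
  have hsub : ∀ X ∈ lieAlgebra E H, ∀ Y ∈ lieAlgebra E H, ⁅X, Y⁆ ∈ lieAlgebra E H :=
    fun X hX Y hY => lie_mem_lieAlgebra hX hY
  have hpair : ∀ x : Module.Basis (Fin (Module.finrank ℝ (TangentModule E H))) ℝ
      (TangentModule E H), (∀ i j, m.form (x i) (x j) = if i = j then 1 else 0) → ∀ j,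
      ∑ i, ∑ k, structConst (fun i => (x i : GroupLieAlgebra 𝓘(ℝ, E) G)) (fun i => x i) i j k ^ 2 =
        1 - 2 * c := fun x hx j =>
    (sum_structConst_sq_of_einstein hsub z hz m.form m.nondegenerate hstd m.pos r hein c X hX hX0
      hcasX x (fun i j => by rw [← hstd, hx]) j).1
  -- The basis y is fixed before `m'` and defines the neighbourhood. The index l exists because X ≠
  -- 0, and it gives d ≥ 0 as a sum of squares.
  obtain ⟨y, hy, l, -⟩ := exists_orthonormal_smul_eq m.form m.symm m.pos
    (⟨X, hX⟩ : TangentModule E H) (fun h => hX0 (congrArg Subtype.val h))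
  have hd0 : 0 ≤ 1 - 2 * c := by
    rw [← hpair y hy l]
    exact Finset.sum_nonneg fun i _ => Finset.sum_nonneg fun k _ => sq_nonneg _
  obtain ⟨δ, hδ, hmin⟩ := exists_pos_forall_diagonal_scalar_ge (1 - 2 * c) hd0 (by linarith)
  -- The extra 1 in the denominator covers dimension 0 and makes the resulting bound on |a_i - 1|
  -- strict.
  have hε : 0 < δ / ((Module.finrank ℝ (TangentModule E H) : ℝ) ^ 2 + 1) := by positivity
  refine Filter.Eventually.filter_mono nhdsWithin_le_nhds
    (m.eventually_basis_close y hε) |>.and self_mem_nhdsWithin |>.mono ?_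
  rintro m' ⟨hclose, hvol⟩
  obtain ⟨x, a, hx, hdiag⟩ := exists_orthonormal_diagonal m.form m'.form m.symm m.pos m'.symm
  have hx' : ∀ i j, -killingForm ℝ (GroupLieAlgebra 𝓘(ℝ, E) G)
      (x i : GroupLieAlgebra 𝓘(ℝ, E) G) (x j) = if i = j then 1 else 0 := fun i j => by
    rw [← hstd, hx]
  have ha : ∀ i, 0 < a i := fun i => by
    have h := hdiag i i
    rw [if_pos rfl] at h
    rw [← h]
    exact m'.pos _ (x.ne_zero i)
  have hnear : ∀ i, |a i - 1| < δ := fun i => by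
    have h := abs_sub_le_of_basis_close m.form m'.form y hy hclose (x i) (by rw [hx, if_pos rfl])
    rw [hdiag, if_pos rfl, Fintype.card_fin] at h
    refine h.trans_lt ?_
    rw [mul_div_assoc', div_lt_iff₀ (by positivity)]
    linarith
  have hprod : ∏ i, a i = 1 :=
    prod_eq_one_of_sqrt_det_eq m.form m'.form (Module.finBasis ℝ (TangentModule E H)) x hx a ha
      hdiag (Eq.trans hvol (Eq.symm hv))
  have hrow : ∀ i, ∑ j, ∑ k, structConst (fun i => (x i : GroupLieAlgebra 𝓘(ℝ, E) G))
      (fun i => x i) i j k ^ 2 = 1 - 2 * c := fun i => by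
    rw [← hpair x hx i]
    refine Finset.sum_congr rfl fun j _ => Finset.sum_congr rfl fun k _ => ?_
    rw [structConst_swap, neg_sq]
  -- The value at a = 1; it is the lower bound in `hmin`.
  have hS : m.scalarCurvature = (Module.finrank ℝ (TangentModule E H) : ℝ) / 2 -
      (Module.finrank ℝ (TangentModule E H) : ℝ) * (1 - 2 * c) / 4 := by
    refine (scalar_diagonal_of_einstein hsub z hz c x hx' (hpair x hx) m.form m.nondegenerate
      (fun _ => 1) (fun _ => one_pos) hx).trans ?_
    simp only [mul_one, div_one, hrow, Finset.sum_const, Finset.card_univ, Fintype.card_fin,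
      nsmul_eq_mul]
    ring
  have hS' := scalar_diagonal_of_einstein hsub z hz c x hx' (hpair x hx) m'.form m'.nondegenerate
    a ha hdiag
  have hfin := hmin (fun i j k => structConst (fun i => (x i : GroupLieAlgebra 𝓘(ℝ, E) G))
    (fun i => x i) i j k ^ 2) a (fun i j k => by rw [structConst_rotate])
    (fun i j k => sq_nonneg _) hrow ha hnear hprod
  rw [Fintype.card_fin] at hfin
  rw [hS]
  exact hfin.trans_eq hS'.symm
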